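/- **Setting.** For a $k$-tuple $S=(s_1,\dots,s_k)$ of elements of a group $G$, formal commutators over $S^{\pm1}$ are the letters $s_i^{\pm1}$ and, inductively, the expressions $c=[c_1,c_2]$; each has an image in $G$, with $[a,b]=a^{-1}b^{-1}ab$. A weight system $\mathfrak w$ assigns to the letters $s_i^{\pm1}$ a weight $w_i\in(0,\infty)\times\mathbb R^{d}$ (lexicographic order, $d\ge0$), extended by $w([c_1,c_2])=w(c_1)+w(c_2)$; its values are listed as $\bar w_1<\bar w_2<\cdots$. Let $G_j^{\mathfrak w}$ be the subgroup generated by the images of all $c$ with $w(c)\ge\bar w_j$, and $R_j^{\mathfrak w}$ the torsion free rank of the abelian group $G_j^{\mathfrak w}/G_{j+1}^{\mathfrak w}$. A weight-function system $\mathfrak F$ consists of increasing functions $F_i:[1,\infty)\to[1,\infty)$, extended by $F_{s_i^{\pm1}}=F_i$ and $F_{[c_1,c_2]}=F_{c_1}F_{c_2}$. It is assumed that (F1) there is $C\ge1$ with $2F_i(r)\le F_i(Cr)$ and $F_i(2r)\le CF_i(r)$ for all $i$ and all $r\ge1$; (F2) for all formal commutators $c,c'$: $w(c)\le w(c')$ if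 and only if there is $C\ge 1$ with $F_c(r)\le C F_{c'}(r)$ for all $r\ge1$. Put $F_S=F_{i_0}$ for a letter $s_{i_0}$ of least weight, and let $\mathbf F_j$ be functions with $\mathbf F_j\simeq F_c$ (up to constant factors) for every $c$ with $w(c)=\bar w_j$. For increasing unbounded $F:[1,\infty)\to[1,\infty)$ let $F^{-1}(x)=\inf\{r\ge1: F(r)\ge x\}$ for $x>0$ and $F^{-1}(0)=0$. Let $\|e\|_{S,\mathfrak F}=0$ and, for $g\ne e$, let $\|g\|_{S,\mathfrak F}$ be the infimum of the $r\ge1$ such that $g$ is represented by a word in the letters $s_i^{\pm1}$ in which $s_i^{\pm1}$ occurs at most $F_i(F_S^{-1}(r))$ times, for each $i$. Let $Q(S,\mathfrak F,r)=\{g: F_S^{-1}(\|g\|_{S,\mathfrak F})\le r\}$. For $g\in G$ of infinite order, $j_{\mathfrak w}(g)$ is the largest $j$ such that $g^u\in G_j^{\mathfrak w}$ for some integer $u\ge1$. An adapted tuple is a tuple $\Sigma=(c_1,\dots,c_t)$ of formal commutators with nondecreasing weights such that, for each $j$, those $c_i$ with $w(c_i)=\bar w_j$ generate $G_j^{\mathfrak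 w}$ modulo $G_{j+1}^{\mathfrak w}$ and the first $R_j^{\mathfrak w}$ of them are free in $G_j^{\mathfrak w}/G_{j+1}^{\mathfrak w}$; $\mathrm{core}(\mathfrak w,S,\Sigma)$ is the subsequence of $S$ of the letters that occur in at least one of these free $c_i$. **Theorem.** Let $G$ be a nilpotent group with two finite generating tuples $S,S'$, weight systems $\mathfrak w,\mathfrak w'$ (possibly of different dimensions) and weight-function systems $\mathfrak F,\mathfrak F'$ on $S$, $S'$, each pair satisfying (F1)–(F2). Let $\Sigma$ be an adapted tuple for $(S,\mathfrak w)$ and let $K>0$. Consider the conditions (i) $S'\supset\mathrm{core}(\mathfrak w,S,\Sigma)$, i.e. there is an injective map $J$ from the indices of the core to those of $S'$ with $s'_{J(i)}=s_i$ in $G$, and $F_i\le K F'_{J(i)}$ on $[1,\infty)$ for every core index $i$; (ii) $F'_{s}\le K\,\mathbf F_{j_{\mathfrak w}(s)}$ on $[1,\infty)$ for every entry $s$ of $S'$ of infinite order in $G$. 1. If (i) holds, there is $C>0$ with $(F'_{S'})^{-1}(\|g\|_{S',\mathfrak F'})\le C\,F_S^{-1}(\|g\|_{S,\mathfrak F})$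 for all $g\in G$. 2. If (ii) holds, there is $c>0$ with $(F'_{S'})^{-1}(\|g\|_{S',\mathfrak F'})\ge c\,F_S^{-1}(\|g\|_{S,\mathfrak F})$ for all $g\in G$. 3. If (i) and (ii) hold, then $(F'_{S'})^{-1}(\|\cdot\|_{S',\mathfrak F'})\simeq F_S^{-1}(\|\cdot\|_{S,\mathfrak F})$ on $G$ (two-sided bounds with positive constants), all balls are finite, and $\#Q(S',\mathfrak F',r)\simeq\#Q(S,\mathfrak F,r)$, i.e. there are $a_1,\dots,a_4>0$ with $$a_1\,\#Q(S,\mathfrak F,a_2r)\le\#Q(S',\mathfrak F',r)\le a_3\,\#Q(S,\mathfrak F,a_4r)\qquad\text{for all } r>0.$$ -/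

import Mathlib

namespace NilpotentNorms

/-- Formal commutators over the alphabet `s₁^{±1}, …, s_k^{±1}`; `letter i true` is the letter
`sᵢ` and `letter i false` is its formal inverse. -/
inductive FormalComm (k : ℕ) : Type
  | letter (i : Fin k) (ε : Bool) : FormalComm k
  | bracket (a b : FormalComm k) : FormalComm k

namespace FormalComm

variable {k : ℕ} {G : Type*} [Group G]

/-- The image in `G` of a formal commutator, with `[a,b] = a⁻¹ b⁻¹ a b`. -/
def eval (s : Fin k → G) : FormalComm k → G
  | letter i ε => if ε then s i else (s i)⁻¹
  | bracket a b => (eval s a)⁻¹ * (eval s b)⁻¹ * eval s a * eval s b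

/-- The indices of the generators that occur in the build-word of a formal commutator. -/
def letters : FormalComm k → Set (Fin k)
  | letter i _ => {i}
  | bracket a b => letters a ∪ letters b

/-- The formal inverse: `sᵢ ↔ sᵢ⁻¹` and `[a,b] ↦ [b,a]`. -/
def inv : FormalComm k → FormalComm k
  | letter i ε => letter i (!ε)
  | bracket a b => bracket b a

theorem eval_inv (s : Fin k → G) (c : FormalComm k) : eval s c.inv = (eval s c)⁻¹ := by
  cases c with
  | letter i ε => cases ε <;> simp [inv, eval]
  | bracket a b => simp [inv, eval, mul_assoc]

end FormalComm

open FormalComm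

/-- A weight system on `k` letters with values in `(0,∞) × ℝ^d`, a subset of `ℝ^{1+d}` with the
lexicographic order. -/
structure WeightSystem (k d : ℕ) where
  /-- the weight of each letter -/
  w : Fin k → Lex (Fin (d + 1) → ℝ)
  pos : ∀ i, 0 < w i 0

namespace WeightSystem

variable {k d : ℕ} (𝔴 : WeightSystem k d)

/-- The weight of a formal commutator. -/
def weight : FormalComm k → Lex (Fin (d + 1) → ℝ)
  | letter i _ => 𝔴.w i
  | bracket a b => weight a + weight b

/-- The increasing sequence of the values of the weight, indexed from `0`: `wbar 0` is the least
value and `wbar (j + 1)` is the least value that exceeds `wbar j`. -/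
noncomputable def wbar : ℕ → Lex (Fin (d + 1) → ℝ)
  | 0 => Classical.epsilon fun v => IsLeast (Set.range 𝔴.weight) v
  | j + 1 => Classical.epsilon fun v => IsLeast {v ∈ Set.range 𝔴.weight | wbar j < v} v

theorem weight_inv (c : FormalComm k) : 𝔴.weight c.inv = 𝔴.weight c := by
  cases c with
  | letter i ε => rfl
  | bracket a b => exact add_comm _ _

theorem weight_zero_pos (c : FormalComm k) : 0 < 𝔴.weight c 0 := by
  induction c with
  | letter i ε => exact 𝔴.pos i
  | bracket a b ha hb => exact add_pos ha hb

theorem weight_pos (c : FormalComm k) : 0 < 𝔴.weight c :=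
  ⟨0, fun j hj => absurd hj (Fin.not_lt_zero j), 𝔴.weight_zero_pos c⟩

theorem finite_weight_le (v : Lex (Fin (d + 1) → ℝ)) :
    {u ∈ Set.range 𝔴.weight | u ≤ v}.Finite := by
  have key : ∀ c : FormalComm k, ∃ n : Fin k → ℕ,
      𝔴.weight c = ∑ i, n i • 𝔴.w i ∧ ∀ i, (n i : ℝ) * 𝔴.w i 0 ≤ 𝔴.weight c 0 := by
    intro c
    induction c with
    | letter i ε =>
      refine ⟨Pi.single i 1, ?_, fun j => ?_⟩
      · rw [Finset.sum_eq_single i] <;> simp +contextual [weight]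
      · by_cases h : j = i
        · subst h; simp [weight]
        · simpa [Pi.single_apply, h] using (𝔴.weight_zero_pos (letter i ε)).le
    | bracket a b ha hb =>
      obtain ⟨n, hn, hn'⟩ := ha
      obtain ⟨m, hm, hm'⟩ := hb
      refine ⟨n + m, ?_, fun i => ?_⟩
      · simp only [weight, hn, hm, Pi.add_apply, add_smul, Finset.sum_add_distrib]
      · have h : 𝔴.weight (bracket a b) 0 = 𝔴.weight a 0 + 𝔴.weight b 0 := rfl
        rw [h, Pi.add_apply, Nat.cast_add, add_mul]
        exact add_le_add (hn' i) (hm' i)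
  have hfin : (Set.univ.pi fun i : Fin k => Set.Iic ⌊v 0 / 𝔴.w i 0⌋₊).Finite :=
    Set.Finite.pi fun i => Set.finite_Iic _
  refine (hfin.image fun n : Fin k → ℕ => ∑ i, n i • 𝔴.w i).subset ?_
  rintro _ ⟨⟨c, rfl⟩, hc⟩
  obtain ⟨n, hn, hn'⟩ := key c
  refine ⟨n, fun i _ => Nat.le_floor ?_, hn.symm⟩
  rw [le_div_iff₀ (𝔴.pos i)]
  exact (hn' i).trans (Pi.apply_le_of_toLex hc fun j hj => absurd hj (Fin.not_lt_zero j))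

theorem exists_isLeast {A : Set (Lex (Fin (d + 1) → ℝ))} (hA : A ⊆ Set.range 𝔴.weight)
    (hne : A.Nonempty) : ∃ v, IsLeast A v := by
  obtain ⟨u, hu⟩ := hne
  have hfin : {x ∈ A | x ≤ u}.Finite :=
    (𝔴.finite_weight_le u).subset fun x hx => ⟨hA hx.1, hx.2⟩
  obtain ⟨v, hv, hmin⟩ := Set.exists_min_image _ id hfin ⟨u, hu, le_rfl⟩
  refine ⟨v, hv.1, fun x hx => ?_⟩
  rcases le_total x u with h | h
  · exact hmin x ⟨hx, h⟩
  · exact hv.2.trans h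

theorem wbar_zero_isLeast [NeZero k] : IsLeast (Set.range 𝔴.weight) (𝔴.wbar 0) :=
  Classical.epsilon_spec (𝔴.exists_isLeast le_rfl ⟨_, letter 0 true, rfl⟩)

theorem wbar_succ_isLeast {j : ℕ} (h : ∃ c, 𝔴.wbar j < 𝔴.weight c) :
    IsLeast {v ∈ Set.range 𝔴.weight | 𝔴.wbar j < v} (𝔴.wbar (j + 1)) := by
  obtain ⟨c, hc⟩ := h
  have hne : {v ∈ Set.range 𝔴.weight | 𝔴.wbar j < v}.Nonempty := ⟨𝔴.weight c, ⟨c, rfl⟩, hc⟩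
  exact Classical.epsilon_spec (𝔴.exists_isLeast (fun _ hx => hx.1) hne)

theorem wbar_succ_le {j : ℕ} {c : FormalComm k} (h : 𝔴.wbar j < 𝔴.weight c) :
    𝔴.wbar (j + 1) ≤ 𝔴.weight c :=
  (𝔴.wbar_succ_isLeast ⟨c, h⟩).2 ⟨⟨c, rfl⟩, h⟩

theorem wbar_mem_range [NeZero k] (j : ℕ) : 𝔴.wbar j ∈ Set.range 𝔴.weight := by
  induction j with
  | zero => exact 𝔴.wbar_zero_isLeast.1
  | succ j ih =>
    obtain ⟨c, hc⟩ := ih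
    refine (𝔴.wbar_succ_isLeast ⟨bracket c c, ?_⟩).1.1
    rw [← hc]
    exact lt_add_of_pos_right _ (𝔴.weight_pos c)

theorem wbar_strictMono [NeZero k] : StrictMono 𝔴.wbar := by
  refine strictMono_nat_of_lt_succ fun j => ?_
  obtain ⟨c, hc⟩ := 𝔴.wbar_mem_range j
  refine (𝔴.wbar_succ_isLeast ⟨bracket c c, ?_⟩).1.2
  rw [← hc]
  exact lt_add_of_pos_right _ (𝔴.weight_pos c)

/-- The sequence `wbar` enumerates all values of the weight. -/
theorem range_wbar [NeZero k] : Set.range 𝔴.wbar = Set.range 𝔴.weight := by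
  refine Set.Subset.antisymm (Set.range_subset_iff.2 𝔴.wbar_mem_range) ?_
  rintro _ ⟨c, rfl⟩
  by_contra hc
  have hlt : ∀ j, 𝔴.wbar j < 𝔴.weight c := by
    intro j
    induction j with
    | zero =>
      exact lt_of_le_of_ne (𝔴.wbar_zero_isLeast.2 ⟨c, rfl⟩) fun h => hc ⟨0, h⟩
    | succ j ih => exact lt_of_le_of_ne (𝔴.wbar_succ_le ih) fun h => hc ⟨j + 1, h⟩
  exact Set.infinite_range_of_injective 𝔴.wbar_strictMono.injective
    ((𝔴.finite_weight_le (𝔴.weight c)).subset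
      (Set.range_subset_iff.2 fun j => ⟨𝔴.wbar_mem_range j, (hlt j).le⟩))

end WeightSystem

section Filtration

variable {G : Type*} [Group G] {k d : ℕ} (s : Fin k → G) (𝔴 : WeightSystem k d)

/-- The subgroup generated by the images of all formal commutators of weight at least
`wbar j`. -/
def filt (j : ℕ) : Subgroup G :=
  Subgroup.closure (eval s '' {c | 𝔴.wbar j ≤ 𝔴.weight c})

variable {s 𝔴} in
theorem eval_mem_filt {j : ℕ} {c : FormalComm k} (h : 𝔴.wbar j ≤ 𝔴.weight c) :
    eval s c ∈ filt s 𝔴 j :=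
  Subgroup.subset_closure ⟨c, h, rfl⟩

theorem filt_le_normalizer (j : ℕ) :
    filt s 𝔴 j ≤ Subgroup.normalizer (filt s 𝔴 (j + 1) : Set G) := by
  have conj : ∀ c a : FormalComm k, ∀ h ∈ filt s 𝔴 (j + 1),
      (eval s a)⁻¹ * h * eval s a ∈ filt s 𝔴 (j + 1) := by
    intro c a h hh
    induction hh using Subgroup.closure_induction with
    | mem x hx =>
      obtain ⟨b, hb, rfl⟩ := hx
      have e : (eval s a)⁻¹ * eval s b * eval s a = eval s b * eval s (bracket b a) := by
        simp [eval, mul_assoc]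
      rw [e]
      refine mul_mem (eval_mem_filt hb) (eval_mem_filt (hb.trans ?_))
      exact (lt_add_of_pos_right _ (𝔴.weight_pos a)).le
    | one => simp
    | mul x y _ _ hx hy => simpa [mul_assoc] using mul_mem hx hy
    | inv x _ hx => simpa [mul_assoc] using inv_mem hx
  refine (Subgroup.closure_le _).2 ?_
  rintro _ ⟨a, -, rfl⟩
  refine Subgroup.mem_normalizer_iff''.2 fun h => ⟨conj a a h, fun hh => ?_⟩
  have := conj a a.inv _ hh
  rw [eval_inv] at this
  simpa [mul_assoc] using this

instance filt_normal (j : ℕ) : ((filt s 𝔴 (j + 1)).subgroupOf (filt s 𝔴 j)).Normal :=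
  Subgroup.normal_subgroupOf_of_le_normalizer (filt_le_normalizer s 𝔴 j)

/-- The quotient of two successive terms of the filtration. -/
abbrev LevelQuot (j : ℕ) : Type _ :=
  filt s 𝔴 j ⧸ (filt s 𝔴 (j + 1)).subgroupOf (filt s 𝔴 j)

theorem levelQuot_comm (j : ℕ) (x y : LevelQuot s 𝔴 j) : x * y = y * x := by
  set N := (filt s 𝔴 (j + 1)).subgroupOf (filt s 𝔴 j) with hN
  let A : Set (filt s 𝔴 j) := (↑) ⁻¹' (eval s '' {c | 𝔴.wbar j ≤ 𝔴.weight c})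
  have hA : Subgroup.closure A = ⊤ := Subgroup.closure_closure_coe_preimage
  have h1 : ∀ a ∈ A, ∀ b ∈ A, (a : LevelQuot s 𝔴 j) * b = b * a := by
    rintro ⟨a, ha⟩ ⟨c, hc, rfl⟩ ⟨b, hb⟩ ⟨c', hc', rfl⟩
    rw [← QuotientGroup.mk_mul, ← QuotientGroup.mk_mul, eq_comm, QuotientGroup.eq,
      Subgroup.mem_subgroupOf]
    have e : (eval s c' * eval s c)⁻¹ * (eval s c * eval s c') = eval s (bracket c c') := by
      simp [eval, mul_assoc]
    change (eval s c' * eval s c)⁻¹ * (eval s c * eval s c') ∈ _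
    rw [e]
    refine eval_mem_filt (𝔴.wbar_succ_le (lt_of_le_of_lt hc ?_))
    exact lt_add_of_pos_right _ (𝔴.weight_pos c')
  have h2 : ∀ a ∈ A, ∀ b : filt s 𝔴 j, (a : LevelQuot s 𝔴 j) * b = b * a := by
    intro a ha b
    have hb : b ∈ Subgroup.closure A := hA ▸ Subgroup.mem_top b
    induction hb using Subgroup.closure_induction with
    | mem x hx => exact h1 a ha x hx
    | one => simp
    | mul x y _ _ hx hy => exact Commute.mul_right hx hy
    | inv x _ hx => exact Commute.inv_right hx
  obtain ⟨a, rfl⟩ := QuotientGroup.mk_surjective x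
  obtain ⟨b, rfl⟩ := QuotientGroup.mk_surjective y
  have ha : a ∈ Subgroup.closure A := hA ▸ Subgroup.mem_top a
  induction ha using Subgroup.closure_induction with
  | mem x hx => exact h2 x hx b
  | one => simp
  | mul x y _ _ hx hy => exact Commute.mul_left hx hy
  | inv x _ hx => exact Commute.inv_left hx

instance levelQuotCommGroup (j : ℕ) : CommGroup (LevelQuot s 𝔴 j) :=
  { (inferInstance : Group (LevelQuot s 𝔴 j)) with mul_comm := levelQuot_comm s 𝔴 j }

/-- The torsion free rank of the abelian group `filt j / filt (j + 1)`. -/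
noncomputable def levelRank (j : ℕ) : ℕ :=
  Module.finrank ℤ (Additive (LevelQuot s 𝔴 j))

/-- The class in `filt j / filt (j + 1)` of a commutator of weight at least `wbar j`. -/
def levelClass (j : ℕ) (c : FormalComm k) (h : 𝔴.wbar j ≤ 𝔴.weight c) :
    Additive (LevelQuot s 𝔴 j) :=
  Additive.ofMul (QuotientGroup.mk ⟨eval s c, eval_mem_filt h⟩)

variable {t : ℕ} (cs : Fin t → FormalComm k)

open Classical in
/-- The set of the first `levelRank j` indices among those `i` with `w(cᵢ) = wbar j`, for a tuple
`(cᵢ)` with nondecreasing weights. -/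
def freeIndices (j : ℕ) : Set (Fin t) :=
  {i | 𝔴.weight (cs i) = 𝔴.wbar j ∧
    (i : ℕ) < (Finset.univ.filter fun i' => 𝔴.weight (cs i') < 𝔴.wbar j).card + levelRank s 𝔴 j}

/-- An adapted tuple of formal commutators: the weights are nondecreasing and, for each `j`, the
members of weight `wbar j` generate `filt j` modulo `filt (j + 1)` and the first `levelRank j` of
them are free (linearly independent over `ℤ`) in `filt j / filt (j + 1)`. -/
structure IsAdapted : Prop where
  monotone : Monotone fun i => 𝔴.weight (cs i)
  generates : ∀ j, Subgroup.closure ((fun i => eval s (cs i)) '' {i | 𝔴.weight (cs i) = 𝔴.wbar j})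
    ⊔ filt s 𝔴 (j + 1) = filt s 𝔴 j
  free : ∀ j, LinearIndependent ℤ fun i : freeIndices s 𝔴 cs j =>
    levelClass s 𝔴 j (cs i) i.2.1.ge

/-- `core(𝔴, S, Σ)`, as a set of indices of letters: those occurring in the build-word of some
free member of the tuple. -/
def core : Set (Fin k) :=
  {δ | ∃ j, ∃ i ∈ freeIndices s 𝔴 cs j, δ ∈ (cs i).letters}

/-- `j = j_𝔴(g)` (indexed from `0`): the largest `j` such that some positive power of `g` lies in
`filt j`. No such `j` exists if `g` is a torsion element. -/
def IsDepth (g : G) (j : ℕ) : Prop :=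
  IsGreatest {j | ∃ u : ℕ, 0 < u ∧ g ^ u ∈ filt s 𝔴 j} j

end Filtration

/-- A system of weight functions: increasing functions `Fᵢ : [1,∞) → [1,∞)` (the values outside
`[1,∞)` are irrelevant). -/
structure WeightFunctions (k : ℕ) where
  /-- the weight function of each letter -/
  F : Fin k → ℝ → ℝ
  monotoneOn : ∀ i, MonotoneOn (F i) (Set.Ici 1)
  one_le : ∀ i r, 1 ≤ r → 1 ≤ F i r

/-- The generalized inverse of an increasing unbounded function `[1,∞) → [1,∞)`, extended to
`(-∞, 0]` by `0`. -/
noncomputable def genInv (f : ℝ → ℝ) (x : ℝ) : ℝ :=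
  if x ≤ 0 then 0 else sInf {r | 1 ≤ r ∧ x ≤ f r}

namespace WeightFunctions

variable {k d : ℕ} (𝔉 : WeightFunctions k)

/-- The weight function of a formal commutator. -/
def comm : FormalComm k → ℝ → ℝ
  | letter i _ => 𝔉.F i
  | bracket a b => fun r => comm a r * comm b r

/-- `2 Fᵢ(r) ≤ Fᵢ(C r)` and `Fᵢ(2 r) ≤ C Fᵢ(r)`. -/
def Doubling : Prop :=
  ∃ C : ℝ, 1 ≤ C ∧ ∀ i, ∀ r, 1 ≤ r → 2 * 𝔉.F i r ≤ 𝔉.F i (C * r) ∧ 𝔉.F i (2 * r) ≤ C * 𝔉.F i r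

/-- Compatibility with a weight system: `w(c) ≤ w(c')` if and only if `F_c = O(F_{c'})`. -/
def Compatible (𝔴 : WeightSystem k d) : Prop :=
  ∀ c c' : FormalComm k, 𝔴.weight c ≤ 𝔴.weight c' ↔
    ∃ C : ℝ, 1 ≤ C ∧ ∀ r, 1 ≤ r → 𝔉.comm c r ≤ C * 𝔉.comm c' r

/-- `Fbar j` is, up to constant factors, the weight function of all formal commutators of weight
`wbar j`. -/
def IsLevelFunction (𝔴 : WeightSystem k d) (Fbar : ℕ → ℝ → ℝ) : Prop :=
  ∀ j c, 𝔴.weight c = 𝔴.wbar j →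
    ∃ a b : ℝ, 0 < a ∧ 0 < b ∧ ∀ r, 1 ≤ r → a * 𝔉.comm c r ≤ Fbar j r ∧ Fbar j r ≤ b * 𝔉.comm c r

end WeightFunctions

section Norm

variable {G : Type*} [Group G] {k : ℕ}

/-- The element of `G` represented by a word in the letters `sᵢ^{±1}`. -/
def wordEval (s : Fin k → G) (ω : List (Fin k × Bool)) : G :=
  (ω.map fun p => if p.2 then s p.1 else (s p.1)⁻¹).prod

/-- The number of occurrences of `sᵢ^{±1}` in a word. -/
def deg (i : Fin k) (ω : List (Fin k × Bool)) : ℕ :=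
  ω.countP fun p => p.1 = i

open Classical in
/-- The quasi-norm `‖g‖_{S,𝔉}`, where `F_S = F_{i₀}` for a letter `i₀` of least weight. -/
noncomputable def qnorm (s : Fin k → G) (𝔉 : WeightFunctions k) (i₀ : Fin k) (g : G) : ℝ :=
  if g = 1 then 0 else
    sInf {r | 1 ≤ r ∧ ∃ ω, wordEval s ω = g ∧
      ∀ i, (deg i ω : ℝ) ≤ 𝔉.F i (genInv (𝔉.F i₀) r)}

/-- The normalized quasi-norm `F_S⁻¹(‖g‖_{S,𝔉})`. -/
noncomputable def normalized (s : Fin k → G) (𝔉 : WeightFunctions k) (i₀ : Fin k) (g : G) : ℝ :=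
  genInv (𝔉.F i₀) (qnorm s 𝔉 i₀ g)

/-- The ball `Q(S,𝔉,r)`. -/
def ball (s : Fin k → G) (𝔉 : WeightFunctions k) (i₀ : Fin k) (r : ℝ) : Set G :=
  {g | normalized s 𝔉 i₀ g ≤ r}

end Norm

end NilpotentNorms

open NilpotentNorms

/-! Fix a scale R and give each formal commutator c the size F_c(R). Let a word cost the sum of the
reciprocal sizes of its letters, so that cost M allows at most M·F_c(R) copies of c. Exchanging a
and b creates [a,b], whose cost is the product of theirs; conjugation by a word of cost M' thus
multiplies costs by at most exp(M'). Collection therefore keeps costs bounded independently of R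
(`Coll.gather`, `Coll.comm`), and it stops after finitely many levels because all sufficiently heavy
commutators are trivial.

Let c be a commutator in core letters. Powers c^x with x ≤ M·F_c(R) have words in S' using
O(F'_i(R)) copies of each letter. For c = [a,b], write x = mq + r with m close to F_a(R); up to
heavier commutators, [a,b]^x is [a^m,b^q][a^r,b] (`exists_pow_error`), and the error is removed by
descending induction on weight (`uReach_pow`). Any other element of a level has a power that is a
product of free commutators of that level and an element of the next level. This is why letters are
only required to have a power in the filtration term prescribed by their label. Brackets preserve
this condition, because commuting powers in a nilpotent group force a torsion commutator
(`isOfFinOrder_commutator`). Descending induction on the level then handles all words of bounded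
cost (`levelReach`); at the bottom only the finite torsion subgroup remains.

Both estimates are instances of `uReach_words`. For the upper bound, words in S are rewritten in S',
each letter being its own label. For the lower bound, words in S' are rewritten in S, an entry of
infinite order being labelled by a commutator at the level of its depth; condition (ii) bounds the
cost of its occurrences. Doubling turns constant factors in letter counts into constant factors in
the scale. -/

namespace NilpotentNorms

open FormalComm

/-! ### Torsion and commuting powers in nilpotent groups -/

section Torsion

open Subgroup
open scoped commutatorElement

/-- Modulo the third term of the lower central series the commutator subgroup is central, so its
product with a cyclic group is abelian. -/
theorem commutator_mem_lowerCentralSeries_two {G : Type*} [Group G] (x : G) {u v : G}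
    (hu : u ∈ zpowers x ⊔ commutator G) (hv : v ∈ zpowers x ⊔ commutator G) :
    ⁅u, v⁆ ∈ (⊤ : Subgroup G).lowerCentralSeries 2 := by
  set M := (⊤ : Subgroup G).lowerCentralSeries 2 with hM
  have hc : ∀ g ∈ commutator G, ∀ h : G, Commute (g : G ⧸ M) (h : G ⧸ M) := by
    intro g hg h
    rw [← commutatorElement_eq_one_iff_commute]
    have : ⁅g, h⁆ ∈ M := by
      rw [hM, Subgroup.lowerCentralSeries_succ, top_lowerCentralSeries_one]
      exact commutator_mem_commutator hg (mem_top h)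
    exact (QuotientGroup.eq_one_iff _).2 this
  rw [← QuotientGroup.eq_one_iff]
  change ⁅(u : G ⧸ M), (v : G ⧸ M)⁆ = 1
  rw [commutatorElement_eq_one_iff_commute]
  obtain ⟨a, ha, b, hb, rfl⟩ := mem_sup_of_normal_right.1 hu
  obtain ⟨a', ha', b', hb', rfl⟩ := mem_sup_of_normal_right.1 hv
  obtain ⟨i, rfl⟩ := mem_zpowers_iff.1 ha
  obtain ⟨i', rfl⟩ := mem_zpowers_iff.1 ha'
  rw [QuotientGroup.mk_mul, QuotientGroup.mk_mul]
  refine Commute.mul_left (Commute.mul_right ?_ (hc _ hb' _).symm)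
    (Commute.mul_right (hc _ hb _) (hc _ hb _))
  exact (Commute.refl (x : G ⧸ M)).zpow_zpow i i'

theorem lowerCentralSeries_zpowers_sup {G : Type*} [Group G] (x : G) (n : ℕ) :
    (zpowers x ⊔ commutator G).lowerCentralSeries (n + 1) ≤
      (⊤ : Subgroup G).lowerCentralSeries (n + 2) := by
  induction n with
  | zero =>
    rw [Subgroup.lowerCentralSeries_succ, Subgroup.lowerCentralSeries_zero]
    exact commutator_le.2 fun u hu v hv => commutator_mem_lowerCentralSeries_two x hu hv
  | succ n ih =>
    rw [Subgroup.lowerCentralSeries_succ, Subgroup.lowerCentralSeries_succ _ (n + 2)]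
    exact commutator_mono ih le_top

/-- The subgroup ⟨x⟩[G,G] has a smaller class bound than G and, being normal, contains all
conjugates of x. The inductions on the class below rest on it. -/
theorem lowerCentralSeries_top_zpowers_sup {G : Type*} [Group G] (x : G) (n : ℕ)
    (h : (⊤ : Subgroup G).lowerCentralSeries (n + 2) = ⊥) :
    (⊤ : Subgroup (zpowers x ⊔ commutator G : Subgroup G)).lowerCentralSeries (n + 1) = ⊥ := by
  have h1 := lowerCentralSeries_zpowers_sup x n
  rw [h, le_bot_iff] at h1
  rw [← (zpowers x ⊔ commutator G).top_subtype_lowerCentralSeries] at h1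
  exact (Subgroup.map_eq_bot_iff_of_injective _ (subtype_injective _)).1 h1

instance normal_zpowers_sup_commutator {G : Type*} [Group G] (x : G) :
    (zpowers x ⊔ commutator G).Normal := by
  refine ⟨fun n hn g => ?_⟩
  have : g * n * g⁻¹ = ⁅g, n⁆ * n := by simp [commutatorElement_def]
  rw [this]
  exact mul_mem (mem_sup_right (commutator_mem_commutator (mem_top _) (mem_top _))) hn

theorem commute_of_lowerCentralSeries_one {G : Type*} [Group G]
    (h : (⊤ : Subgroup G).lowerCentralSeries 1 = ⊥) (x y : G) : Commute x y := by
  rw [← commutatorElement_eq_one_iff_commute, ← mem_bot, ← h, top_lowerCentralSeries_one]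
  exact commutator_mem_commutator (mem_top _) (mem_top _)

/-- (xy)^m is a product of conjugates of x followed by y^m. The conjugates lie in ⟨x⟩[G,G], where
induction applies; m is then chosen with y^m = 1. -/
theorem isOfFinOrder_mul_of_lowerCentralSeries (n : ℕ) :
    ∀ (G : Type*) [Group G], (⊤ : Subgroup G).lowerCentralSeries (n + 1) = ⊥ →
      ∀ x y : G, IsOfFinOrder x → IsOfFinOrder y → IsOfFinOrder (x * y) := by
  induction n with
  | zero =>
    intro G _ h x y hx hy
    exact (commute_of_lowerCentralSeries_one h x y).isOfFinOrder_mul hx hy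
  | succ n ih =>
    intro G _ h x y hx hy
    set H := zpowers x ⊔ commutator G with hH
    have ihH := ih H (lowerCentralSeries_top_zpowers_sup x n h)
    have key : ∀ m : ℕ, ∃ t ∈ H, IsOfFinOrder t ∧ (x * y) ^ m = t * y ^ m := by
      intro m
      induction m with
      | zero => exact ⟨1, one_mem _, IsOfFinOrder.one, by simp⟩
      | succ m ihm =>
        obtain ⟨t, htH, ht, e⟩ := ihm
        have hxH : y ^ m * x * (y ^ m)⁻¹ ∈ H :=
          Normal.conj_mem inferInstance _ (mem_sup_left (mem_zpowers x)) _
        have hx' : IsOfFinOrder (y ^ m * x * (y ^ m)⁻¹) := by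
          exact (MulAut.conj (y ^ m)).toMonoidHom.isOfFinOrder hx
        refine ⟨t * (y ^ m * x * (y ^ m)⁻¹), mul_mem htH hxH, ?_, ?_⟩
        · have := ihH ⟨t, htH⟩ ⟨_, hxH⟩ (Submonoid.isOfFinOrder_coe.1 ht)
            (Submonoid.isOfFinOrder_coe.1 hx')
          exact Submonoid.isOfFinOrder_coe.2 this
        · rw [pow_succ, e, pow_succ]; group
    obtain ⟨m, hm, hym⟩ := isOfFinOrder_iff_pow_eq_one.1 hy
    obtain ⟨t, -, ht, e⟩ := key m
    rw [hym, mul_one] at e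
    rw [← e] at ht
    exact (isOfFinOrder_pow.1 ht).resolve_right hm.ne'

variable (G : Type*) [Group G] [Group.IsNilpotent G]

theorem exists_lowerCentralSeries_succ_eq_bot :
    ∃ n, (⊤ : Subgroup G).lowerCentralSeries (n + 1) = ⊥ := by
  obtain ⟨n, hn⟩ := Subgroup.nilpotent_iff_lowerCentralSeries.1 ‹Group.IsNilpotent G›
  exact ⟨n, le_bot_iff.1 (hn ▸ Subgroup.lowerCentralSeries_antitone _ n.le_succ)⟩

/-- The torsion elements of a nilpotent group form a subgroup. -/
def torsionSubgroup : Subgroup G where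
  carrier := {x | IsOfFinOrder x}
  one_mem' := IsOfFinOrder.one
  mul_mem' {x y} hx hy := by
    obtain ⟨n, hn⟩ := exists_lowerCentralSeries_succ_eq_bot G
    exact isOfFinOrder_mul_of_lowerCentralSeries n G hn x y hx hy
  inv_mem' hx := IsOfFinOrder.inv hx

variable {G}

theorem mem_torsionSubgroup {x : G} : x ∈ torsionSubgroup G ↔ IsOfFinOrder x := Iff.rfl

instance normal_torsionSubgroup : (torsionSubgroup G).Normal :=
  ⟨fun _ hx g => (MulAut.conj g).toMonoidHom.isOfFinOrder hx⟩

/-- With z = y⁻¹xy one has z^u = x^u, so x^u commutes with z and induction in ⟨x⟩[G,G] makes [x,z]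
torsion. Modulo torsion x and z then commute, whence (x⁻¹z)^u = 1, and x⁻¹z = [x,y]. -/
theorem isOfFinOrder_commutator_of_lowerCentralSeries (n : ℕ) :
    ∀ (G : Type*) [Group G] [Group.IsNilpotent G],
      (⊤ : Subgroup G).lowerCentralSeries (n + 1) = ⊥ →
      ∀ (x y : G) (u : ℕ), 0 < u → Commute (x ^ u) y → IsOfFinOrder (x⁻¹ * y⁻¹ * x * y) := by
  induction n with
  | zero =>
    intro G _ _ h x y u _ _
    have : x⁻¹ * y⁻¹ * x * y = 1 := by
      rw [mul_assoc, (commute_of_lowerCentralSeries_one h x y).eq]; group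
    rw [this]; exact IsOfFinOrder.one
  | succ n ih =>
    intro G _ _ h x y u hu hxy
    set H := zpowers x ⊔ commutator G with hH
    have ihH := ih H (lowerCentralSeries_top_zpowers_sup x n h)
    have hxH : x ∈ H := mem_sup_left (mem_zpowers x)
    set z := y⁻¹ * x * y with hz
    have hzH : z ∈ H := by
      simpa using Normal.conj_mem (inferInstance : H.Normal) x hxH y⁻¹
    have hzu : z ^ u = x ^ u := by
      have : z ^ u = y⁻¹ * x ^ u * y := by
        have := conj_pow (a := y⁻¹) (b := x) (i := u)
        rwa [inv_inv] at this
      rw [this, mul_assoc, hxy.eq]; group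
    have hcomm : Commute ((⟨x, hxH⟩ : H) ^ u) ⟨z, hzH⟩ := by
      refine Subtype.ext ?_
      change x ^ u * z = z * x ^ u
      rw [← hzu, ← pow_succ, ← pow_succ']
    have h1 := Submonoid.isOfFinOrder_coe.2 (ihH ⟨x, hxH⟩ ⟨z, hzH⟩ u hu hcomm)
    change IsOfFinOrder (x⁻¹ * z⁻¹ * x * z) at h1
    have h2 : Commute (x : G ⧸ torsionSubgroup G) (z : G ⧸ torsionSubgroup G) := by
      have : ((z * x)⁻¹ * (x * z) : G) ∈ torsionSubgroup G := by
        rw [mem_torsionSubgroup]; convert h1 using 1; group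
      exact (QuotientGroup.eq.2 this).symm
    have h3 : (x⁻¹ * z) ^ u ∈ torsionSubgroup G := by
      rw [← QuotientGroup.eq_one_iff]
      change ((x : G ⧸ torsionSubgroup G)⁻¹ * (z : G ⧸ torsionSubgroup G)) ^ u = 1
      rw [h2.inv_left.mul_pow, inv_pow, ← QuotientGroup.mk_pow, ← QuotientGroup.mk_pow, hzu]
      simp
    have h4 := (isOfFinOrder_pow.1 h3).resolve_right hu.ne'
    convert h4 using 1
    rw [hz]; group

/-- The one-sided version is used twice: first for x and y^v, then for y and x modulo torsion. -/
theorem isOfFinOrder_commutator {x y : G} {u v : ℕ} (hu : 0 < u) (hv : 0 < v)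
    (h : Commute (x ^ u) (y ^ v)) : IsOfFinOrder (x⁻¹ * y⁻¹ * x * y) := by
  obtain ⟨n, hn⟩ := exists_lowerCentralSeries_succ_eq_bot G
  have h1 := isOfFinOrder_commutator_of_lowerCentralSeries n G hn x (y ^ v) u hu h
  obtain ⟨m, hm⟩ := exists_lowerCentralSeries_succ_eq_bot (G ⧸ torsionSubgroup G)
  have h2 : Commute ((y : G ⧸ torsionSubgroup G) ^ v) (x : G ⧸ torsionSubgroup G) := by
    have : ((y ^ v * x)⁻¹ * (x * y ^ v) : G) ∈ torsionSubgroup G := by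
      rw [mem_torsionSubgroup]; convert h1 using 1; group
    exact QuotientGroup.eq.2 this
  have h3 := isOfFinOrder_commutator_of_lowerCentralSeries m _ hm _ _ v hv h2
  obtain ⟨i, hi, h4⟩ := isOfFinOrder_iff_pow_eq_one.1 h3
  have h5 : (y⁻¹ * x⁻¹ * y * x) ^ i ∈ torsionSubgroup G := by
    rw [← QuotientGroup.eq_one_iff]; exact h4
  have h6 := ((isOfFinOrder_pow.1 h5).resolve_right hi.ne').inv
  convert h6 using 1
  group

end Torsion

/-! ### Collection with a budget -/

section Collection

variable {G : Type*} [Group G] {k : ℕ}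

/-- The commutator of two group elements labelled by formal commutators. -/
def br (a b : G × FormalComm k) : G × FormalComm k :=
  (a.1⁻¹ * b.1⁻¹ * a.1 * b.1, bracket a.2 b.2)

/-- A multiplicative size function with values in `[1, ∞)` on formal commutators. -/
structure IsSize (φ : FormalComm k → ℝ) : Prop where
  one_le : ∀ c, 1 ≤ φ c
  map_bracket : ∀ a b, φ (bracket a b) = φ a * φ b

/-- `Coll φ D U n M g`: the element `g` is a product of `n` letters from `D` and some letters
from `U`, and the reciprocals of the sizes of these letters add up to at most `M`. -/
inductive Coll (φ : FormalComm k → ℝ) (D U : Set (G × FormalComm k)) : ℕ → ℝ → G → Prop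
  | one : Coll φ D U 0 0 1
  | mark {n M g a} : Coll φ D U n M g → a ∈ D → Coll φ D U (n + 1) (M + (φ a.2)⁻¹) (g * a.1)
  | cons {n M g a} : Coll φ D U n M g → a ∈ U → Coll φ D U n (M + (φ a.2)⁻¹) (g * a.1)
  | mono {n M M' g} : Coll φ D U n M g → M ≤ M' → Coll φ D U n M' g

namespace Coll

variable {φ : FormalComm k → ℝ} {D U D' U' D₁ U₁ D₂ U₂ : Set (G × FormalComm k)} {n n' : ℕ}
  {M M' : ℝ} {g g' : G}

theorem subset (h : Coll φ D U n M g) (hD : D ⊆ D') (hU : U ⊆ U') : Coll φ D' U' n M g := by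
  induction h with
  | one => exact one
  | mark _ ha ih => exact ih.mark (hD ha)
  | cons _ ha ih => exact ih.cons (hU ha)
  | mono _ hM ih => exact ih.mono hM

theorem unmark (h : Coll φ D U n M g) : Coll φ ∅ (D ∪ U) 0 M g := by
  induction h with
  | one => exact one
  | mark _ ha ih => exact ih.cons (Or.inl ha)
  | cons _ ha ih => exact ih.cons (Or.inr ha)
  | mono _ hM ih => exact ih.mono hM

/-- Marks only count the letters of `D`, so that collecting them later yields an exact exponent. -/
theorem exists_mark (h : Coll φ ∅ (D ∪ U) n M g) : ∃ m, Coll φ D U m M g := by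
  induction h with
  | one => exact ⟨0, one⟩
  | mark _ ha ih => exact absurd ha (Set.notMem_empty _)
  | cons _ ha ih =>
    obtain ⟨m, hm⟩ := ih
    rcases ha with ha | ha
    · exact ⟨m + 1, hm.mark ha⟩
    · exact ⟨m, hm.cons ha⟩
  | mono _ hM ih =>
    obtain ⟨m, hm⟩ := ih
    exact ⟨m, hm.mono hM⟩

theorem mul (h : Coll φ D U n M g) (h' : Coll φ D U n' M' g') :
    Coll φ D U (n + n') (M + M') (g * g') := by
  induction h' with
  | one => simpa using h
  | mark _ ha ih => rw [← mul_assoc, ← add_assoc, ← add_assoc]; exact ih.mark ha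
  | cons _ ha ih => rw [← mul_assoc, ← add_assoc]; exact ih.cons ha
  | mono _ hM ih => exact ih.mono (by gcongr)

theorem mem_subgroup {H : Subgroup G} (h : Coll φ D U n M g) (hD : ∀ a ∈ D, a.1 ∈ H)
    (hU : ∀ a ∈ U, a.1 ∈ H) : g ∈ H := by
  induction h with
  | one => exact one_mem H
  | mark _ ha ih => exact mul_mem ih (hD _ ha)
  | cons _ ha ih => exact mul_mem ih (hU _ ha)
  | mono _ _ ih => exact ih

theorem mark_one {a : G × FormalComm k} (ha : a ∈ D) : Coll φ D U 1 (φ a.2)⁻¹ a.1 := by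
  simpa using (one (φ := φ) (D := D) (U := U)).mark ha

theorem cons_one {a : G × FormalComm k} (ha : a ∈ U) : Coll φ D U 0 (φ a.2)⁻¹ a.1 := by
  simpa using (one (φ := φ) (D := D) (U := U)).cons ha

theorem pow (h : Coll φ D U n M g) (q : ℕ) : Coll φ D U (q * n) (q * M) (g ^ q) := by
  induction q with
  | zero => simpa using one
  | succ q ih =>
    rw [pow_succ, Nat.succ_mul, Nat.cast_succ, add_mul, one_mul]
    exact ih.mul h

section

variable (hφ : IsSize φ)
include hφ

theorem _root_.NilpotentNorms.IsSize.pos (c : FormalComm k) : 0 < φ c :=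
  zero_lt_one.trans_le (hφ.one_le c)

theorem _root_.NilpotentNorms.IsSize.inv_nonneg (c : FormalComm k) : 0 ≤ (φ c)⁻¹ :=
  _root_.inv_nonneg.2 (hφ.pos c).le

theorem _root_.NilpotentNorms.IsSize.inv_br (a b : G × FormalComm k) :
    (φ (br a b).2)⁻¹ = (φ a.2)⁻¹ * (φ b.2)⁻¹ := by
  rw [br, hφ.map_bracket, mul_inv]

theorem nonneg (h : Coll φ D U n M g) : 0 ≤ M := by
  induction h with
  | one => exact le_rfl
  | mark _ _ ih => exact add_nonneg ih (hφ.inv_nonneg _)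
  | cons _ _ ih => exact add_nonneg ih (hφ.inv_nonneg _)
  | mono _ hM ih => exact ih.trans hM

/-- Each letter a turns into a·[a,b], and the extra bracket costs the fraction 1/φ(b) of the cost of
a. Marked letters survive, so their number is unchanged. -/
theorem conj_letter {b : G × FormalComm k} (hD : ∀ a ∈ D, br a b ∈ U) (hU : ∀ a ∈ U, br a b ∈ U)
    (h : Coll φ D U n M g) :
    Coll φ D U n (M * (1 + (φ b.2)⁻¹)) (b.1⁻¹ * g * b.1) := by
  induction h with
  | one => simpa using one
  | @mark n M g a _ ha ih =>
    have e : b.1⁻¹ * (g * a.1) * b.1 = b.1⁻¹ * g * b.1 * a.1 * (br a b).1 := by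
      simp only [br]; group
    rw [e]
    refine ((ih.mark ha).cons (hD a ha)).mono (le_of_eq ?_)
    rw [hφ.inv_br]; ring
  | @cons n M g a _ ha ih =>
    have e : b.1⁻¹ * (g * a.1) * b.1 = b.1⁻¹ * g * b.1 * a.1 * (br a b).1 := by
      simp only [br]; group
    rw [e]
    refine ((ih.cons ha).cons (hU a ha)).mono (le_of_eq ?_)
    rw [hφ.inv_br]; ring
  | mono _ hM ih =>
    have := hφ.inv_nonneg b.2
    exact ih.mono (by gcongr)

/-- Iterating over the letters b of the conjugating word gives the factor ∏(1 + 1/φ(b)) ≤ exp(∑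
1/φ(b)). -/
theorem conj (hg : Coll φ D U n M g) (hh : Coll φ D' U' n' M' g')
    (hcl : ∀ a ∈ D ∪ U, ∀ b ∈ D' ∪ U', br a b ∈ U) :
    Coll φ D U n (M * Real.exp M') (g'⁻¹ * g * g') := by
  have hM := hg.nonneg hφ
  have step : ∀ (n' : ℕ) {M₁ : ℝ} {h : G} {b : G × FormalComm k}, b ∈ D' ∪ U' →
      Coll φ D U n (M * Real.exp M₁) (h⁻¹ * g * h) →
      Coll φ D U n (M * Real.exp (M₁ + (φ b.2)⁻¹)) ((h * b.1)⁻¹ * g * (h * b.1)) := by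
    intro _ M₁ h b hb ih
    have e : (h * b.1)⁻¹ * g * (h * b.1) = b.1⁻¹ * (h⁻¹ * g * h) * b.1 := by group
    rw [e]
    refine (ih.conj_letter hφ (fun a ha => hcl a (Or.inl ha) b hb)
      (fun a ha => hcl a (Or.inr ha) b hb)).mono ?_
    rw [mul_assoc, Real.exp_add]
    have := Real.add_one_le_exp (φ b.2)⁻¹
    gcongr
    linarith
  induction hh with
  | one => simpa using hg
  | mark _ ha ih => exact step 0 (Or.inl ha) ih
  | cons _ ha ih => exact step 0 (Or.inr ha) ih
  | mono _ hM ih => exact ih.mono (by gcongr)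

theorem gather {d : G × FormalComm k} (hU : ∀ a ∈ U, br a d ∈ U)
    (h : Coll φ {d} U n M g) :
    (n : ℝ) ≤ M * φ d.2 ∧ ∃ h, g = d.1 ^ n * h ∧ Coll φ ∅ U 0 (M * Real.exp M) h := by
  -- Here m is the cost of the unmarked letters alone; each of the n copies of d moved to the left
  -- multiplies the cost of the remainder by at most exp(1/φ(d)).
  have key : ∃ m h, m + n * (φ d.2)⁻¹ ≤ M ∧ 0 ≤ m ∧ g = d.1 ^ n * h ∧
      Coll φ ∅ U 0 (m * Real.exp (n * (φ d.2)⁻¹)) h := by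
    induction h with
    | one => exact ⟨0, 1, by simp, le_rfl, by simp, by simpa using one⟩
    | @mark n M g a _ ha ih =>
      obtain ⟨m, h, hm, hm0, e, hh⟩ := ih
      obtain rfl : a = d := ha
      refine ⟨m, a.1⁻¹ * h * a.1, by push_cast; linarith, hm0, ?_, ?_⟩
      · rw [e, pow_succ]; group
      · refine (hh.conj_letter hφ (by simp) hU).mono ?_
        rw [mul_assoc, Nat.cast_succ, add_mul, one_mul, Real.exp_add]
        have := Real.add_one_le_exp (φ a.2)⁻¹
        gcongr
        linarith
    | @cons n M g a _ ha ih =>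
      obtain ⟨m, h, hm, hm0, e, hh⟩ := ih
      refine ⟨m + (φ a.2)⁻¹, h * a.1, by linarith, add_nonneg hm0 (hφ.inv_nonneg _),
        by rw [e, mul_assoc], (hh.cons ha).mono ?_⟩
      rw [add_mul]
      gcongr
      refine le_mul_of_one_le_right (hφ.inv_nonneg _) (Real.one_le_exp ?_)
      exact mul_nonneg n.cast_nonneg (hφ.inv_nonneg _)
    | mono _ hM ih =>
      obtain ⟨m, h, hm, hm0, e, hh⟩ := ih
      exact ⟨m, h, hm.trans hM, hm0, e, hh⟩
  obtain ⟨m, h, hm, hm0, e, hh⟩ := key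
  have h1 : (n : ℝ) * (φ d.2)⁻¹ ≤ M := by linarith
  have h2 : m ≤ M := by
    have := mul_nonneg n.cast_nonneg (hφ.inv_nonneg d.2)
    linarith
  have h3 := hm0.trans h2
  refine ⟨?_, h, e, hh.mono (by gcongr)⟩
  rwa [← div_eq_mul_inv, div_le_iff₀ (hφ.pos _)] at h1

/-- Induction along g by [x,hb] = [x,b]·[x,h]^b. The bound M·exp(M) absorbs both the new bracket and
the growth under conjugation. -/
theorem letter_comm {x : G × FormalComm k} (hD : ∀ b ∈ D', br x b ∈ D)
    (hU : ∀ b ∈ U', br x b ∈ U) (hcl : ∀ a ∈ D ∪ U, ∀ b ∈ D' ∪ U', br a b ∈ U)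
    (h : Coll φ D' U' n M g) :
    Coll φ D U n ((φ x.2)⁻¹ * (M * Real.exp M)) (x.1⁻¹ * g⁻¹ * x.1 * g) := by
  have e : ∀ (h : G) (b : G × FormalComm k), x.1⁻¹ * (h * b.1)⁻¹ * x.1 * (h * b.1) =
      (br x b).1 * (b.1⁻¹ * (x.1⁻¹ * h⁻¹ * x.1 * h) * b.1) := by
    intro h b; simp only [br]; group
  have hx := hφ.inv_nonneg x.2
  have ineq : ∀ (M : ℝ), 0 ≤ M → ∀ b : G × FormalComm k, (φ (br x b).2)⁻¹ +
      (φ x.2)⁻¹ * (M * Real.exp M) * (1 + (φ b.2)⁻¹) ≤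
      (φ x.2)⁻¹ * ((M + (φ b.2)⁻¹) * Real.exp (M + (φ b.2)⁻¹)) := by
    intro M hM b
    have hb := hφ.inv_nonneg b.2
    have h1 := Real.add_one_le_exp (φ b.2)⁻¹
    have h2 : 1 ≤ Real.exp (M + (φ b.2)⁻¹) := Real.one_le_exp (by positivity)
    rw [hφ.inv_br, mul_assoc, ← mul_add, add_mul]
    refine mul_le_mul_of_nonneg_left ?_ hx
    rw [add_comm]
    refine add_le_add ?_ (le_mul_of_one_le_right hb h2)
    rw [mul_assoc, Real.exp_add]
    gcongr
    linarith
  induction h with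
  | one => simpa using one
  | @mark n M g a hc ha ih =>
    rw [e, add_comm n]
    refine ((mark_one (hD a ha)).mul (ih.conj_letter hφ (fun y hy => hcl y (Or.inl hy) _ (Or.inl ha))
      (fun y hy => hcl y (Or.inr hy) _ (Or.inl ha)))).mono (ineq _ (hc.nonneg hφ) a)
  | @cons n M g a hc ha ih =>
    rw [e, ← zero_add n]
    refine ((cons_one (hU a ha)).mul (ih.conj_letter hφ (fun y hy => hcl y (Or.inl hy) _ (Or.inr ha))
      (fun y hy => hcl y (Or.inr hy) _ (Or.inr ha)))).mono (ineq _ (hc.nonneg hφ) a)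
  | mono hc hM ih =>
    have := (hc.nonneg hφ).trans hM
    exact ih.mono (by gcongr)

/-- Induction on the first factor by [hb,g'] = [h,g']^b·[b,g']. Only brackets of two marked letters
are marked, so the count is exactly n·n'. -/
theorem comm (h₁ : Coll φ D₁ U₁ n M g) (h₂ : Coll φ D₂ U₂ n' M' g')
    (hDD : ∀ a ∈ D₁, ∀ b ∈ D₂, br a b ∈ D) (hDU : ∀ a ∈ D₁, ∀ b ∈ U₂, br a b ∈ U)
    (hUD : ∀ a ∈ U₁, ∀ b ∈ D₂ ∪ U₂, br a b ∈ U)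
    (hcl₁ : ∀ a ∈ D ∪ U, ∀ b ∈ D₁ ∪ U₁, br a b ∈ U)
    (hcl₂ : ∀ a ∈ D ∪ U, ∀ b ∈ D₂ ∪ U₂, br a b ∈ U) :
    Coll φ D U (n * n') (M * Real.exp M * (M' * Real.exp M')) (g⁻¹ * g'⁻¹ * g * g') := by
  have hM' := h₂.nonneg hφ
  set L := M' * Real.exp M' with hL
  have hL0 : 0 ≤ L := by positivity
  have e : ∀ (h : G) (b : G × FormalComm k), (h * b.1)⁻¹ * g'⁻¹ * (h * b.1) * g' =
      (b.1⁻¹ * (h⁻¹ * g'⁻¹ * h * g') * b.1) * (b.1⁻¹ * g'⁻¹ * b.1 * g') := by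
    intro h b; group
  have ineq : ∀ (M : ℝ), 0 ≤ M → ∀ b : G × FormalComm k,
      M * Real.exp M * L * (1 + (φ b.2)⁻¹) + (φ b.2)⁻¹ * L ≤
      (M + (φ b.2)⁻¹) * Real.exp (M + (φ b.2)⁻¹) * L := by
    intro M hM b
    have hb := hφ.inv_nonneg b.2
    have h1 := Real.add_one_le_exp (φ b.2)⁻¹
    have h2 : 1 ≤ Real.exp (M + (φ b.2)⁻¹) := Real.one_le_exp (by positivity)
    have h3 : M * Real.exp M * (1 + (φ b.2)⁻¹) ≤ M * Real.exp (M + (φ b.2)⁻¹) := by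
      rw [mul_assoc, Real.exp_add]
      gcongr
      linarith
    have h4 := le_mul_of_one_le_right hb h2
    nlinarith
  induction h₁ with
  | one => simpa using one
  | @mark n M g a hc ha ih =>
    rw [e, Nat.succ_mul]
    have h1 := letter_comm hφ (hDD a ha) (hDU a ha) hcl₂ h₂
    exact ((ih.conj_letter hφ (fun y hy => hcl₁ y (Or.inl hy) _ (Or.inl ha))
      (fun y hy => hcl₁ y (Or.inr hy) _ (Or.inl ha))).mul h1).mono (ineq _ (hc.nonneg hφ) a)
  | @cons n M g a hc ha ih =>
    rw [e, ← add_zero (n * n')]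
    -- Brackets with an unmarked letter must all stay unmarked, so the marks of the second word are
    -- forgotten first.
    have h1 := letter_comm (D := ∅) (U := U) hφ (x := a) (D' := ∅) (U' := D₂ ∪ U₂) (by simp)
      (hUD a ha) (fun y hy b hb => hcl₂ y (Or.inr (by simpa using hy)) b (by simpa using hb))
      h₂.unmark
    exact ((ih.conj_letter hφ (fun y hy => hcl₁ y (Or.inl hy) _ (Or.inr ha))
      (fun y hy => hcl₁ y (Or.inr hy) _ (Or.inr ha))).mul
      (h1.subset (Set.empty_subset _) le_rfl)).mono (ineq _ (hc.nonneg hφ) a)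
  | mono hc hM ih =>
    have := (hc.nonneg hφ).trans hM
    exact ih.mono (by gcongr)

end

end Coll

end Collection

/-! ### Sizes at a scale, and finiteness below a weight -/

theorem WeightFunctions.isSize {k : ℕ} (𝔉 : WeightFunctions k) {R : ℝ} (hR : 1 ≤ R) :
    IsSize fun c => 𝔉.comm c R where
  one_le c := by
    induction c with
    | letter i ε => exact 𝔉.one_le i R hR
    | bracket a b ha hb => exact one_le_mul_of_one_le_of_one_le ha hb
  map_bracket _ _ := rfl

namespace WeightSystem

variable {k d : ℕ} (𝔴 : WeightSystem k d)

theorem weight_lt_bracket_left (a b : FormalComm k) : 𝔴.weight a < 𝔴.weight (bracket a b) :=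
  lt_add_of_pos_right _ (𝔴.weight_pos b)

theorem weight_lt_bracket_right (a b : FormalComm k) : 𝔴.weight b < 𝔴.weight (bracket a b) :=
  lt_add_of_pos_left _ (𝔴.weight_pos a)

theorem weight_le_wbar {j : ℕ} {c : FormalComm k} (h : 𝔴.weight c < 𝔴.wbar (j + 1)) :
    𝔴.weight c ≤ 𝔴.wbar j :=
  not_lt.1 fun h' => (𝔴.wbar_succ_le h').not_gt h

variable [NeZero k]

theorem wbar_zero_le (c : FormalComm k) : 𝔴.wbar 0 ≤ 𝔴.weight c :=
  𝔴.wbar_zero_isLeast.2 ⟨c, rfl⟩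

theorem finite_weight_lt (j : ℕ) : {c | 𝔴.weight c < 𝔴.wbar j}.Finite := by
  induction j with
  | zero =>
    convert Set.finite_empty using 1
    exact Set.eq_empty_of_forall_notMem fun c hc => (𝔴.wbar_zero_le c).not_gt hc
  | succ j ih =>
    refine ((Set.finite_range fun p : Fin k × Bool => letter p.1 p.2).union
      ((ih.prod ih).image fun p => bracket p.1 p.2)).subset ?_
    rintro (⟨i, ε⟩ | ⟨a, b⟩) hc
    · exact Or.inl ⟨(i, ε), rfl⟩
    · have := 𝔴.weight_le_wbar hc
      exact Or.inr ⟨(a, b), ⟨(𝔴.weight_lt_bracket_left a b).trans_le this,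
        (𝔴.weight_lt_bracket_right a b).trans_le this⟩, rfl⟩

theorem exists_wbar_eq (c : FormalComm k) : ∃ j, 𝔴.wbar j = 𝔴.weight c := by
  have : 𝔴.weight c ∈ Set.range 𝔴.wbar := 𝔴.range_wbar ▸ ⟨c, rfl⟩
  exact this

theorem exists_forall_weight_lt {A : Set (FormalComm k)} (hA : A.Finite) :
    ∃ j, ∀ c ∈ A, 𝔴.weight c < 𝔴.wbar j := by
  choose f hf using 𝔴.exists_wbar_eq
  obtain ⟨j, hj⟩ := (hA.image f).bddAbove
  refine ⟨j + 1, fun c hc => ?_⟩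
  rw [← hf c]
  exact 𝔴.wbar_strictMono (Nat.lt_succ_of_le (hj ⟨c, hc, rfl⟩))

end WeightSystem

/-! ### Triviality of heavy commutators -/

section Heights

variable {G : Type*} [Group G] {k : ℕ}

/-- The nesting depth of a formal commutator. -/
def FormalComm.height : FormalComm k → ℕ
  | letter _ _ => 0
  | bracket a b => max (height a) (height b) + 1

theorem finite_height_le (n : ℕ) : {c : FormalComm k | c.height ≤ n}.Finite := by
  have hl := Set.finite_range fun p : Fin k × Bool => letter p.1 p.2
  induction n with
  | zero =>
    refine hl.subset ?_
    rintro (⟨i, ε⟩ | ⟨a, b⟩) hc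
    · exact ⟨(i, ε), rfl⟩
    · simp [FormalComm.height] at hc
  | succ n ih =>
    refine (hl.union ((ih.prod ih).image fun p => bracket p.1 p.2)).subset ?_
    rintro (⟨i, ε⟩ | ⟨a, b⟩) hc
    · exact Or.inl ⟨(i, ε), rfl⟩
    · have : max a.height b.height ≤ n := Nat.le_of_succ_le_succ hc
      exact Or.inr ⟨(a, b), max_le_iff.1 this, rfl⟩

open scoped commutatorElement in
theorem eval_mem_lowerCentralSeries (s : Fin k → G) (c : FormalComm k) :
    eval s c ∈ (⊤ : Subgroup G).lowerCentralSeries c.height := by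
  induction c with
  | letter i ε => exact Subgroup.mem_top _
  | bracket a b ha hb =>
    have e : eval s (bracket a b) = ⁅(eval s a)⁻¹, (eval s b)⁻¹⁆ := by
      simp [eval, commutatorElement_def]
    rw [e, FormalComm.height]
    rcases le_total a.height b.height with h | h
    · rw [max_eq_right h, Subgroup.lowerCentralSeries_succ, Subgroup.commutator_comm]
      exact Subgroup.commutator_mem_commutator (Subgroup.mem_top _) (inv_mem hb)
    · rw [max_eq_left h, Subgroup.lowerCentralSeries_succ]
      exact Subgroup.commutator_mem_commutator (inv_mem ha) (Subgroup.mem_top _)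

/-- Only finitely many formal commutators have bounded nesting depth, so a heavy one is deep, and a
deep one dies in the lower central series. -/
theorem exists_eval_eq_one [Group.IsNilpotent G] [NeZero k] {d : ℕ} (s : Fin k → G)
    (𝔴 : WeightSystem k d) : ∃ J, ∀ c, 𝔴.wbar J ≤ 𝔴.weight c → eval s c = 1 := by
  obtain ⟨n, hn⟩ := Subgroup.nilpotent_iff_lowerCentralSeries.1 ‹Group.IsNilpotent G›
  obtain ⟨J, hJ⟩ := 𝔴.exists_forall_weight_lt (finite_height_le n)
  refine ⟨J, fun c hc => ?_⟩
  have h : n ≤ c.height := by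
    by_contra h
    exact (hJ c (not_le.1 h).le).not_ge hc
  rw [← Subgroup.mem_bot, ← hn]
  exact Subgroup.lowerCentralSeries_antitone _ h (eval_mem_lowerCentralSeries s c)

end Heights

/-! ### Isolators of the filtration -/

section Isolators

variable {G : Type*} [Group G] {k d : ℕ} (s : Fin k → G) (𝔴 : WeightSystem k d)

/-- The subgroup generated by the images of all formal commutators of weight at least `v`. -/
def filtGE (v : Lex (Fin (d + 1) → ℝ)) : Subgroup G :=
  Subgroup.closure (eval s '' {c | v ≤ 𝔴.weight c})

variable {s 𝔴}

theorem eval_mem_filtGE {v : Lex (Fin (d + 1) → ℝ)} {c : FormalComm k} (h : v ≤ 𝔴.weight c) :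
    eval s c ∈ filtGE s 𝔴 v :=
  Subgroup.subset_closure ⟨c, h, rfl⟩

theorem filtGE_antitone : Antitone (filtGE s 𝔴) := fun _ _ h =>
  Subgroup.closure_mono (Set.image_mono fun _ hc => le_trans h hc)

theorem filt_antitone [NeZero k] : Antitone (filt s 𝔴) := fun _ _ h =>
  filtGE_antitone (𝔴.wbar_strictMono.monotone h)

theorem filtGE_normal (hs : Subgroup.closure (Set.range s) = ⊤) (v : Lex (Fin (d + 1) → ℝ)) :
    (filtGE s 𝔴 v).Normal := by
  rw [← Subgroup.normalizer_eq_top_iff, eq_top_iff, ← hs, Subgroup.closure_le]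
  have conj : ∀ a : FormalComm k, ∀ h ∈ filtGE s 𝔴 v,
      (eval s a)⁻¹ * h * eval s a ∈ filtGE s 𝔴 v := by
    intro a h hh
    induction hh using Subgroup.closure_induction with
    | mem x hx =>
      obtain ⟨b, hb, rfl⟩ := hx
      have e : (eval s a)⁻¹ * eval s b * eval s a = eval s b * eval s (bracket b a) := by
        simp [eval, mul_assoc]
      rw [e]
      exact mul_mem (eval_mem_filtGE hb)
        (eval_mem_filtGE (hb.trans (𝔴.weight_lt_bracket_left b a).le))
    | one => simp
    | mul x y _ _ hx hy => simpa [mul_assoc] using mul_mem hx hy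
    | inv x _ hx => simpa [mul_assoc] using inv_mem hx
  rintro _ ⟨i, rfl⟩
  refine Subgroup.mem_normalizer_iff''.2 fun h => ⟨conj (letter i true) h, fun hh => ?_⟩
  have := conj (letter i false) _ hh
  simpa [eval, mul_assoc] using this

/-- Generators commute modulo the normal subgroup `filtGE s 𝔴 (v + v')`. Indexing by weight values
rather than by levels makes this additivity expressible. -/
theorem commutator_mem_filtGE (hs : Subgroup.closure (Set.range s) = ⊤)
    {v v' : Lex (Fin (d + 1) → ℝ)} {x y : G} (hx : x ∈ filtGE s 𝔴 v) (hy : y ∈ filtGE s 𝔴 v') :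
    (y * x)⁻¹ * (x * y) ∈ filtGE s 𝔴 (v + v') := by
  set M := filtGE s 𝔴 (v + v') with hM
  have : M.Normal := filtGE_normal hs _
  rw [← QuotientGroup.eq, QuotientGroup.mk_mul, QuotientGroup.mk_mul, eq_comm]
  change Commute (x : G ⧸ M) (y : G ⧸ M)
  induction hx using Subgroup.closure_induction with
  | one => exact Commute.one_left _
  | mul _ _ _ _ h h' => exact h.mul_left h'
  | inv _ _ h => exact h.inv_left
  | mem x hx =>
    obtain ⟨a, ha, rfl⟩ := hx
    induction hy using Subgroup.closure_induction with
    | one => exact Commute.one_right _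
    | mul _ _ _ _ h h' => exact h.mul_right h'
    | inv _ _ h => exact h.inv_right
    | mem y hy =>
      obtain ⟨b, hb, rfl⟩ := hy
      refine (QuotientGroup.eq.2 ?_).symm
      have e : (eval s b * eval s a)⁻¹ * (eval s a * eval s b) = eval s (bracket a b) := by
        simp [eval, mul_assoc]
      rw [e]
      exact eval_mem_filtGE (add_le_add ha hb)

variable (s 𝔴) in
/-- A labelled element is admissible if it lies in the isolator of the term of the filtration
that its label prescribes. -/
def Admissible (a : G × FormalComm k) : Prop :=
  ∃ u : ℕ, 0 < u ∧ a.1 ^ u ∈ filtGE s 𝔴 (𝔴.weight a.2)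

/-- In the quotient by the filtration term of the summed weight, powers of the two elements commute,
so their commutator is torsion there. -/
theorem Admissible.br [Group.IsNilpotent G] (hs : Subgroup.closure (Set.range s) = ⊤)
    {a b : G × FormalComm k} (ha : Admissible s 𝔴 a) (hb : Admissible s 𝔴 b) :
    Admissible s 𝔴 (br a b) := by
  obtain ⟨u, hu, hau⟩ := ha
  obtain ⟨v, hv, hbv⟩ := hb
  set M := filtGE s 𝔴 (𝔴.weight a.2 + 𝔴.weight b.2) with hM
  have : M.Normal := filtGE_normal hs _
  have h : Commute ((a.1 : G ⧸ M) ^ u) ((b.1 : G ⧸ M) ^ v) :=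
    (QuotientGroup.eq.2 (commutator_mem_filtGE hs hau hbv)).symm
  obtain ⟨n, hn, e⟩ := isOfFinOrder_iff_pow_eq_one.1 (isOfFinOrder_commutator hu hv h)
  exact ⟨n, hn, (QuotientGroup.eq_one_iff (N := M) _).1 e⟩

/-- The closure of a set of labelled elements under commutators. -/
inductive BrClosure (A : Set (G × FormalComm k)) : G × FormalComm k → Prop
  | base {a} : a ∈ A → BrClosure A a
  | br {a b} : BrClosure A a → BrClosure A b → BrClosure A (br a b)

theorem BrClosure.admissible [Group.IsNilpotent G] (hs : Subgroup.closure (Set.range s) = ⊤)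
    {A : Set (G × FormalComm k)} (hA : ∀ a ∈ A, Admissible s 𝔴 a) {a : G × FormalComm k}
    (ha : BrClosure A a) : Admissible s 𝔴 a := by
  induction ha with
  | base h => exact hA _ h
  | br _ _ h h' => exact h.br hs h'

variable (𝔴) in
/-- A set of labelled elements with finitely many members of each weight. -/
def FiniteBelow (A : Set (G × FormalComm k)) : Prop :=
  ∀ j, {a ∈ A | 𝔴.weight a.2 < 𝔴.wbar j}.Finite

theorem FiniteBelow.brClosure [NeZero k] {A : Set (G × FormalComm k)}
    (hA : FiniteBelow 𝔴 A) : FiniteBelow 𝔴 {a | BrClosure A a} := by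
  intro j
  induction j with
  | zero =>
    convert Set.finite_empty using 1
    exact Set.eq_empty_of_forall_notMem fun c hc => (𝔴.wbar_zero_le c.2).not_gt hc.2
  | succ j ih =>
    refine ((hA (j + 1)).union ((ih.prod ih).image fun p => NilpotentNorms.br p.1 p.2)).subset ?_
    rintro _ ⟨h | @⟨a, b, ha, hb⟩, hw⟩
    · exact Or.inl ⟨h, hw⟩
    · have := 𝔴.weight_le_wbar hw
      exact Or.inr ⟨(a, b), ⟨⟨ha, (𝔴.weight_lt_bracket_left a.2 b.2).trans_le this⟩,
        ⟨hb, (𝔴.weight_lt_bracket_right a.2 b.2).trans_le this⟩⟩, rfl⟩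

theorem filt_zero [NeZero k] (hs : Subgroup.closure (Set.range s) = ⊤) : filt s 𝔴 0 = ⊤ := by
  rw [eq_top_iff, ← hs, Subgroup.closure_le]
  rintro _ ⟨i, rfl⟩
  exact eval_mem_filt (c := letter i true) (𝔴.wbar_zero_le _)

theorem exists_filt_eq_bot [Group.IsNilpotent G] [NeZero k] : ∃ J, filt s 𝔴 J = ⊥ := by
  obtain ⟨J, hJ⟩ := exists_eval_eq_one s 𝔴
  refine ⟨J, Subgroup.closure_eq_bot_iff.2 ?_⟩
  rintro _ ⟨c, hc, rfl⟩
  exact hJ c hc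

end Isolators

/-! ### Ranks of the levels and finiteness of torsion -/

section Levels

variable {G : Type*} [Group G] {k d : ℕ} {s : Fin k → G} {𝔴 : WeightSystem k d}
  {t : ℕ} {cs : Fin t → FormalComm k}

theorem exists_rep_of_mem_span (j : ℕ) {ι : Type*} (f : ι → filt s 𝔴 j)
    {v : Additive (LevelQuot s 𝔴 j)}
    (hv : v ∈ Submodule.span ℤ (Set.range fun i => (Additive.ofMul (f i : LevelQuot s 𝔴 j)))) :
    ∃ p : filt s 𝔴 j, (p : G) ∈ Subgroup.closure (Set.range fun i => (f i : G)) ∧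
      v = Additive.ofMul (p : LevelQuot s 𝔴 j) := by
  induction hv using Submodule.span_induction with
  | mem x hx =>
    obtain ⟨i, rfl⟩ := hx
    exact ⟨f i, Subgroup.subset_closure ⟨i, rfl⟩, rfl⟩
  | zero => exact ⟨1, one_mem _, rfl⟩
  | add x y _ _ hx hy =>
    obtain ⟨p, hp, rfl⟩ := hx
    obtain ⟨q, hq, rfl⟩ := hy
    exact ⟨p * q, mul_mem hp hq, rfl⟩
  | smul n x _ hx =>
    obtain ⟨p, hp, rfl⟩ := hx
    exact ⟨p ^ n, zpow_mem hp n, rfl⟩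

theorem span_levelClass_eq_top (hcs : IsAdapted s 𝔴 cs) (j : ℕ) :
    Submodule.span ℤ (Set.range fun i : {i // 𝔴.weight (cs i) = 𝔴.wbar j} =>
      levelClass s 𝔴 j (cs i) i.2.ge) = ⊤ := by
  set W := Submodule.span ℤ (Set.range fun i : {i // 𝔴.weight (cs i) = 𝔴.wbar j} =>
      levelClass s 𝔴 j (cs i) i.2.ge) with hW
  let Q : Subgroup (filt s 𝔴 j) :=
    (AddSubgroup.toSubgroup' W.toAddSubgroup).comap (QuotientGroup.mk' _)
  have hQ : filt s 𝔴 j ≤ Q.map (filt s 𝔴 j).subtype := by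
    refine (hcs.generates j).ge.trans (sup_le ((Subgroup.closure_le _).2 ?_) ?_)
    · rintro _ ⟨i, hi, rfl⟩
      exact ⟨⟨eval s (cs i), eval_mem_filt (le_of_eq hi.symm)⟩,
        Submodule.subset_span ⟨⟨i, hi⟩, rfl⟩, rfl⟩
    · intro x hx
      have hx' : x ∈ filt s 𝔴 j := by
        rw [← hcs.generates j]; exact Subgroup.mem_sup_right hx
      refine ⟨⟨x, hx'⟩, ?_, rfl⟩
      have : ((⟨x, hx'⟩ : filt s 𝔴 j) : LevelQuot s 𝔴 j) = 1 :=
        (QuotientGroup.eq_one_iff _).2 hx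
      change Additive.ofMul ((⟨x, hx'⟩ : filt s 𝔴 j) : LevelQuot s 𝔴 j) ∈ W
      rw [this]
      exact W.zero_mem
  rw [eq_top_iff]
  intro v _
  obtain ⟨x, hx⟩ := QuotientGroup.mk_surjective v.toMul
  obtain ⟨y, hy, e⟩ := hQ x.2
  have : y = x := Subtype.ext e
  subst this
  have h1 : Additive.ofMul ((y : filt s 𝔴 j) : LevelQuot s 𝔴 j) ∈ W := hy
  rwa [hx] at h1

theorem module_finite_levelQuot (hcs : IsAdapted s 𝔴 cs) (j : ℕ) :
    Module.Finite ℤ (Additive (LevelQuot s 𝔴 j)) := by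
  refine ⟨Submodule.fg_def.2 ⟨_, Set.finite_range _, span_levelClass_eq_top hcs j⟩⟩

/-- `freeIndices` is cut out by position, so it could a priori be too small. If some member of the
level lies beyond the cut, monotonicity of the weights fills all positions before it; otherwise
every member of the level is free, and the members span. -/
theorem levelRank_le_card_freeIndices (hcs : IsAdapted s 𝔴 cs) (j : ℕ) :
    levelRank s 𝔴 j ≤ Nat.card (freeIndices s 𝔴 cs j) := by
  classical
  set n₀ := (Finset.univ.filter fun i' => 𝔴.weight (cs i') < 𝔴.wbar j).card with hn₀
  set I := Finset.univ.filter fun i => 𝔴.weight (cs i) = 𝔴.wbar j with hI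
  have h1 : levelRank s 𝔴 j ≤ I.card := by
    have := finrank_range_le_card (R := ℤ) fun i : {i // 𝔴.weight (cs i) = 𝔴.wbar j} =>
      levelClass s 𝔴 j (cs i) i.2.ge
    rw [Set.finrank, span_levelClass_eq_top hcs j, finrank_top] at this
    rwa [Fintype.card_subtype] at this
  have h2 : (Finset.univ.filter fun i => i ∈ freeIndices s 𝔴 cs j).card =
      Nat.card (freeIndices s 𝔴 cs j) := by
    rw [← Fintype.card_subtype, Nat.card_eq_fintype_card]
  rw [← h2]
  by_cases h : ∃ i, 𝔴.weight (cs i) = 𝔴.wbar j ∧ n₀ + levelRank s 𝔴 j ≤ (i : ℕ)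
  · obtain ⟨i, hi, hle⟩ := h
    have h3 : (Finset.univ.filter fun i' : Fin t => (i' : ℕ) < n₀ + levelRank s 𝔴 j) ⊆
        (Finset.univ.filter fun i' => 𝔴.weight (cs i') < 𝔴.wbar j) ∪
        (Finset.univ.filter fun i => i ∈ freeIndices s 𝔴 cs j) := by
      intro i' hi'
      have hi'' : (i' : ℕ) < n₀ + levelRank s 𝔴 j := by simpa using hi'
      have h4 : 𝔴.weight (cs i') ≤ 𝔴.wbar j := by
        rw [← hi]
        exact hcs.monotone (Fin.le_def.2 (hi''.le.trans hle))
      rcases h4.lt_or_eq with h4 | h4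
      · exact Finset.mem_union_left _ (Finset.mem_filter.2 ⟨Finset.mem_univ _, h4⟩)
      · exact Finset.mem_union_right _ (by simpa using ⟨h4, hi''⟩)
    have h5 := (Finset.card_le_card h3).trans (Finset.card_union_le _ _)
    have h6 : (Finset.univ.filter fun i' : Fin t => (i' : ℕ) < n₀ + levelRank s 𝔴 j).card =
        n₀ + levelRank s 𝔴 j := by
      rw [Fin.card_filter_val_lt, min_eq_right (hle.trans i.2.le)]
    omega
  · push Not at h
    refine h1.trans (Finset.card_le_card fun i hi => ?_)
    have hi' : 𝔴.weight (cs i) = 𝔴.wbar j := by simpa [hI] using hi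
    simpa using ⟨hi', h i hi'⟩

/-- The free members are independent and as numerous as the rank, so the quotient by their span has
rank zero and is torsion. -/
theorem exists_smul_mem_span_free (hcs : IsAdapted s 𝔴 cs) (j : ℕ)
    (v : Additive (LevelQuot s 𝔴 j)) :
    ∃ N : ℕ, 0 < N ∧ N • v ∈ Submodule.span ℤ (Set.range fun i : freeIndices s 𝔴 cs j =>
      levelClass s 𝔴 j (cs i) i.2.1.ge) := by
  classical
  have := module_finite_levelQuot hcs j
  set W := Submodule.span ℤ (Set.range fun i : freeIndices s 𝔴 cs j =>
      levelClass s 𝔴 j (cs i) i.2.1.ge) with hW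
  have h1 : Module.finrank ℤ W = Nat.card (freeIndices s 𝔴 cs j) := by
    rw [Nat.card_eq_fintype_card]
    exact finrank_span_eq_card (hcs.free j)
  have h2 := W.finrank_quotient_add_finrank
  have h3 : Module.finrank ℤ (Additive (LevelQuot s 𝔴 j) ⧸ W) = 0 := by
    have := levelRank_le_card_freeIndices hcs j
    rw [levelRank] at this
    omega
  obtain ⟨⟨a, ha⟩, hav⟩ := (Module.finrank_eq_zero_iff_isTorsion.1 h3) (x := W.mkQ v)
  have ha0 : a ≠ 0 := nonZeroDivisors.ne_zero ha
  have hav' : a • v ∈ W := by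
    rw [← Submodule.Quotient.mk_eq_zero]
    exact hav
  refine ⟨a.natAbs, Int.natAbs_pos.2 ha0, ?_⟩
  rw [← natCast_zsmul, Int.natCast_natAbs]
  rcases abs_choice a with h | h <;> rw [h]
  · exact hav'
  · rw [neg_smul]; exact W.neg_mem hav'

theorem exists_pow_mem_closure_free (hcs : IsAdapted s 𝔴 cs) (j : ℕ) {g : G}
    (hg : g ∈ filt s 𝔴 j) :
    ∃ N : ℕ, 0 < N ∧ ∃ p ∈ Subgroup.closure
      (Set.range fun i : freeIndices s 𝔴 cs j => eval s (cs i)),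
      ∃ h ∈ filt s 𝔴 (j + 1), g ^ N = p * h := by
  obtain ⟨N, hN, hv⟩ := exists_smul_mem_span_free hcs j
    (Additive.ofMul ((⟨g, hg⟩ : filt s 𝔴 j) : LevelQuot s 𝔴 j))
  obtain ⟨p, hp, e⟩ := exists_rep_of_mem_span j
    (fun i : freeIndices s 𝔴 cs j => (⟨eval s (cs i), eval_mem_filt i.2.1.ge⟩ : filt s 𝔴 j)) hv
  have e' : (p : LevelQuot s 𝔴 j) = ((⟨g, hg⟩ ^ N : filt s 𝔴 j) : LevelQuot s 𝔴 j) := e.symm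
  have h1 : (p : G)⁻¹ * g ^ N ∈ filt s 𝔴 (j + 1) :=
    QuotientGroup.eq (s := (filt s 𝔴 (j + 1)).subgroupOf (filt s 𝔴 j)).1 e'
  exact ⟨N, hN, p, hp, (p : G)⁻¹ * g ^ N, h1, by group⟩

/-- Torsion elements map into the finite torsion part of a finitely generated abelian group; two in
the same fibre differ by a torsion element of the next term. -/
theorem finite_torsion_filt [Group.IsNilpotent G] (hcs : IsAdapted s 𝔴 cs) (j : ℕ)
    (h : {g ∈ filt s 𝔴 (j + 1) | IsOfFinOrder g}.Finite) :
    {g ∈ filt s 𝔴 j | IsOfFinOrder g}.Finite := by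
  have := module_finite_levelQuot hcs j
  have hfin : Finite (Submodule.torsion ℤ (Additive (LevelQuot s 𝔴 j))) :=
    Module.finite_of_fg_torsion _ Submodule.torsion_isTorsion
  have key : {g : filt s 𝔴 j | IsOfFinOrder (g : G)}.Finite := by
    refine Set.Finite.of_finite_fibers
      (fun g : filt s 𝔴 j => Additive.ofMul (g : LevelQuot s 𝔴 j)) ?_ ?_
    · refine (Set.toFinite (Submodule.torsion ℤ (Additive (LevelQuot s 𝔴 j)) :
        Set (Additive (LevelQuot s 𝔴 j)))).subset ?_
      rintro _ ⟨g, hg, rfl⟩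
      obtain ⟨n, hn, e⟩ := isOfFinOrder_iff_pow_eq_one.1 (Submonoid.isOfFinOrder_coe.1 hg)
      refine ⟨⟨n, mem_nonZeroDivisors_of_ne_zero (by exact_mod_cast hn.ne')⟩, ?_⟩
      change (n : ℤ) • Additive.ofMul (g : LevelQuot s 𝔴 j) = 0
      rw [natCast_zsmul, ← ofMul_pow, ← QuotientGroup.mk_pow, e]
      rfl
    · rintro _ ⟨g, hg, rfl⟩
      refine Set.Finite.subset (h.preimage (f := fun g' : filt s 𝔴 j => (g : G)⁻¹ * g')
        fun x _ y _ e => Subtype.ext (mul_left_cancel e)) ?_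
      rintro g' ⟨hg', e⟩
      have e' : (g : LevelQuot s 𝔴 j) = (g' : LevelQuot s 𝔴 j) := Eq.symm e
      exact ⟨QuotientGroup.eq (s := (filt s 𝔴 (j + 1)).subgroupOf (filt s 𝔴 j)).1 e',
        mul_mem (inv_mem (mem_torsionSubgroup.2 hg))
          (mem_torsionSubgroup.2 hg')⟩
  refine (key.image Subtype.val).subset ?_
  rintro g ⟨hg, hg'⟩
  exact ⟨⟨g, hg⟩, hg', rfl⟩

theorem finite_isOfFinOrder [Group.IsNilpotent G] [NeZero k]
    (hs : Subgroup.closure (Set.range s) = ⊤)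
    (hcs : IsAdapted s 𝔴 cs) : {g : G | IsOfFinOrder g}.Finite := by
  obtain ⟨J, hJ⟩ := exists_filt_eq_bot (s := s) (𝔴 := 𝔴)
  have hJ' : {g ∈ filt s 𝔴 J | IsOfFinOrder g}.Finite := by
    refine (Set.finite_singleton 1).subset ?_
    rintro g ⟨hg, -⟩
    rw [hJ] at hg
    exact hg
  have h0 : {g ∈ filt s 𝔴 0 | IsOfFinOrder g}.Finite :=
    Nat.decreasingInduction (motive := fun j _ => {g ∈ filt s 𝔴 j | IsOfFinOrder g}.Finite)
      (fun j _ h => finite_torsion_filt hcs j h) hJ' J.zero_le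
  simpa [filt_zero hs] using h0

end Levels

/-! ### Uniformly reachable families -/

section Reach

variable {G : Type*} [Group G] {k' : ℕ} {s' : Fin k' → G} {𝔉' : WeightFunctions k'}

theorem wordEval_append (s' : Fin k' → G) (ω ω' : List (Fin k' × Bool)) :
    wordEval s' (ω ++ ω') = wordEval s' ω * wordEval s' ω' := by
  simp [wordEval]

theorem deg_append (i : Fin k') (ω ω' : List (Fin k' × Bool)) :
    deg i (ω ++ ω') = deg i ω + deg i ω' := by
  simp [deg]

theorem deg_le_length (i : Fin k') (ω : List (Fin k' × Bool)) : deg i ω ≤ ω.length :=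
  List.countP_le_length

variable (s' 𝔉') in
/-- The element `g` is represented by a word in which each letter `sᵢ^{±1}` occurs at most
`C Fᵢ(R)` times. -/
def Reach (C R : ℝ) (g : G) : Prop :=
  ∃ ω, wordEval s' ω = g ∧ ∀ i, (deg i ω : ℝ) ≤ C * 𝔉'.F i R

namespace Reach

variable {C C' R : ℝ} {g g' : G}

theorem one : Reach s' 𝔉' 0 R 1 := ⟨[], by simp [wordEval], by simp [deg]⟩

theorem mul (h : Reach s' 𝔉' C R g) (h' : Reach s' 𝔉' C' R g') :
    Reach s' 𝔉' (C + C') R (g * g') := by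
  obtain ⟨ω, rfl, hω⟩ := h
  obtain ⟨ω', rfl, hω'⟩ := h'
  refine ⟨ω ++ ω', wordEval_append _ _ _, fun i => ?_⟩
  rw [deg_append, Nat.cast_add, add_mul]
  exact add_le_add (hω i) (hω' i)

theorem mono (h : Reach s' 𝔉' C R g) (hR : 1 ≤ R) (hC : C ≤ C') : Reach s' 𝔉' C' R g := by
  obtain ⟨ω, e, hω⟩ := h
  have := fun i => zero_le_one.trans (𝔉'.one_le i R hR)
  exact ⟨ω, e, fun i => (hω i).trans (mul_le_mul_of_nonneg_right hC (this i))⟩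

theorem inv (h : Reach s' 𝔉' C R g) : Reach s' 𝔉' C R g⁻¹ := by
  obtain ⟨ω, rfl, hω⟩ := h
  refine ⟨(ω.map fun p => (p.1, !p.2)).reverse, ?_, fun i => ?_⟩
  · rw [wordEval, wordEval, List.prod_inv_reverse, List.map_reverse, List.map_map, List.map_map]
    congr 2
    refine List.map_congr_left fun p _ => ?_
    cases h : p.2 <;> simp [h]
  · refine le_of_eq_of_le ?_ (hω i)
    simp [deg, List.countP_map, Function.comp_def]

theorem pow (h : Reach s' 𝔉' C R g) (n : ℕ) : Reach s' 𝔉' (n * C) R (g ^ n) := by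
  induction n with
  | zero => simpa using one
  | succ n ih =>
    rw [pow_succ, Nat.cast_succ, add_mul, one_mul]
    exact ih.mul h

end Reach

theorem exists_wordEval (hs' : Subgroup.closure (Set.range s') = ⊤) (g : G) :
    ∃ ω, wordEval s' ω = g := by
  have hg : g ∈ Subgroup.closure (Set.range s') := hs' ▸ Subgroup.mem_top g
  -- Constant weight functions make `Reach` a mere existence statement for words, so its closure
  -- properties apply.
  have : ∃ C : ℝ, Reach s' ⟨fun _ _ => 1, fun _ _ _ _ _ _ => le_rfl, fun _ _ _ => le_rfl⟩ C 1 g := by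
    induction hg using Subgroup.closure_induction with
    | mem x hx =>
      obtain ⟨i, rfl⟩ := hx
      exact ⟨1, [(i, true)], by simp [wordEval], fun j => by
        simpa using (deg_le_length j [(i, true)])⟩
    | one => exact ⟨0, Reach.one⟩
    | mul x y _ _ hx hy => exact ⟨_, hx.choose_spec.mul hy.choose_spec⟩
    | inv x _ hx => exact ⟨_, hx.choose_spec.inv⟩
  obtain ⟨C, ω, h, -⟩ := this
  exact ⟨ω, h⟩

theorem exists_reach (hs' : Subgroup.closure (Set.range s') = ⊤) (g : G) :
    ∃ C, ∀ R, 1 ≤ R → Reach s' 𝔉' C R g := by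
  obtain ⟨ω, h⟩ := exists_wordEval hs' g
  refine ⟨ω.length, fun R hR => ⟨ω, h, fun i => ?_⟩⟩
  calc (deg i ω : ℝ) ≤ ω.length := by exact_mod_cast deg_le_length i ω
    _ ≤ ω.length * 𝔉'.F i R := le_mul_of_one_le_right (Nat.cast_nonneg _) (𝔉'.one_le i R hR)

variable (s' 𝔉') in
/-- The elements in a family depending on a scale are reached uniformly. -/
def UReach (P : ℝ → G → Prop) : Prop :=
  ∃ C, ∀ R, 1 ≤ R → ∀ g, P R g → Reach s' 𝔉' C R g

theorem UReach.mul {P P₁ P₂ : ℝ → G → Prop} (h₁ : UReach s' 𝔉' P₁) (h₂ : UReach s' 𝔉' P₂)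
    (h : ∀ R, 1 ≤ R → ∀ g, P R g → ∃ g₁ g₂, P₁ R g₁ ∧ P₂ R g₂ ∧ g = g₁ * g₂) :
    UReach s' 𝔉' P := by
  obtain ⟨C₁, h₁⟩ := h₁
  obtain ⟨C₂, h₂⟩ := h₂
  refine ⟨C₁ + C₂, fun R hR g hg => ?_⟩
  obtain ⟨g₁, g₂, hg₁, hg₂, rfl⟩ := h R hR g hg
  exact (h₁ R hR _ hg₁).mul (h₂ R hR _ hg₂)

theorem UReach.of_imp {P Q : ℝ → G → Prop} (hQ : UReach s' 𝔉' Q)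
    (h : ∀ R, 1 ≤ R → ∀ g, P R g → Q R g) : UReach s' 𝔉' P := by
  obtain ⟨C, hC⟩ := hQ
  exact ⟨C, fun R hR g hg => hC R hR g (h R hR g hg)⟩

theorem uReach_of_finite (hs' : Subgroup.closure (Set.range s') = ⊤) {A : Set G} (hA : A.Finite) :
    UReach s' 𝔉' fun _ g => g ∈ A := by
  choose f hf using exists_reach (𝔉' := 𝔉') hs'
  obtain ⟨C, hC⟩ := (hA.image f).bddAbove
  exact ⟨C, fun R hR g hg => (hf g R hR).mono hR (hC ⟨g, hg, rfl⟩)⟩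

variable {k : ℕ} {𝔉 : WeightFunctions k}

/-- The letters of `D` are pulled out one at a time. Each extraction replaces the budget M by
M·exp(M), which does not depend on the scale. -/
theorem uReach_of_gather (D : Finset (G × FormalComm k)) (U : Set (G × FormalComm k))
    (hcl : ∀ a ∈ (D : Set (G × FormalComm k)) ∪ U, ∀ b ∈ D, br a b ∈ U)
    (hD : ∀ d ∈ D, ∀ M, UReach s' 𝔉' fun R g => ∃ x : ℕ, x ≤ M * 𝔉.comm d.2 R ∧ g = d.1 ^ x)
    (hU : ∀ M, UReach s' 𝔉' fun R g => Coll (fun c => 𝔉.comm c R) ∅ U 0 M g) (M : ℝ) :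
    UReach s' 𝔉' fun R g => Coll (fun c => 𝔉.comm c R) ∅ (D ∪ U) 0 M g := by
  classical
  induction D using Finset.induction_on generalizing M with
  | empty => simpa using hU M
  | insert d D _ ih =>
    have ih' := ih (fun a ha b hb => hcl a (by
        rcases ha with ha | ha
        · exact Or.inl (Finset.mem_insert_of_mem ha)
        · exact Or.inr ha) b (Finset.mem_insert_of_mem hb))
      (fun b hb => hD b (Finset.mem_insert_of_mem hb)) (M * Real.exp M)
    refine UReach.mul (hD d (Finset.mem_insert_self _ _) M) ih' fun R hR g hg => ?_
    rw [Finset.coe_insert, Set.insert_union, Set.insert_eq] at hg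
    obtain ⟨n, hn⟩ := hg.exists_mark
    obtain ⟨hnM, h, e, hh⟩ := hn.gather (𝔉.isSize hR) fun a ha => Or.inr (hcl a (by
        rcases ha with ha | ha
        · exact Or.inl (Finset.mem_insert_of_mem ha)
        · exact Or.inr ha) d (Finset.mem_insert_self _ _))
    exact ⟨_, h, ⟨n, hnM, rfl⟩, hh, e⟩

end Reach

/-! ### Powers of commutators in available letters -/

section FormalLetters

variable {G : Type*} [Group G] {k k' d : ℕ} {s : Fin k → G} {𝔴 : WeightSystem k d}
  {𝔉 : WeightFunctions k} {s' : Fin k' → G} {𝔉' : WeightFunctions k'} {A : Set (Fin k)}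

variable (s A) in
/-- The formal commutators in the letters from `A` with a given property, as labels of their
images. -/
def formalLetters (p : FormalComm k → Prop) : Set (G × FormalComm k) :=
  {a | a.1 = eval s a.2 ∧ a.2.letters ⊆ A ∧ p a.2}

theorem br_mem_formalLetters {p q r : FormalComm k → Prop} {a b : G × FormalComm k}
    (ha : a ∈ formalLetters s A p) (hb : b ∈ formalLetters s A q)
    (h : p a.2 → q b.2 → r (bracket a.2 b.2)) : br a b ∈ formalLetters s A r := by
  obtain ⟨a, c⟩ := a
  obtain ⟨b, c'⟩ := b
  obtain ⟨ha0, ha1, ha2⟩ := ha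
  obtain ⟨hb0, hb1, hb2⟩ := hb
  obtain rfl : a = eval s c := ha0
  obtain rfl : b = eval s c' := hb0
  exact ⟨rfl, Set.union_subset ha1 hb1, h ha2 hb2⟩

/-- One round of commutators: a power of a bracket up to heavier commutators. -/
theorem bracket_pow_error {a b : FormalComm k} (ha : a.letters ⊆ A) (hb : b.letters ⊆ A)
    {C R : ℝ} (hR : 1 ≤ R) {y z : ℕ} {e f : G}
    (hy : y ≤ C * 𝔉.comm a R) (hz : z ≤ C * 𝔉.comm b R)
    (he : Coll (fun c => 𝔉.comm c R) ∅
      (formalLetters s A fun c => 𝔴.weight a < 𝔴.weight c) 0 C e)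
    (hf : Coll (fun c => 𝔉.comm c R) ∅
      (formalLetters s A fun c => 𝔴.weight b < 𝔴.weight c) 0 C f)
    (hra : Reach s' 𝔉' C R (eval s a ^ y * e)) (hrb : Reach s' 𝔉' C R (eval s b ^ z * f)) :
    ∃ g, Coll (fun c => 𝔉.comm c R) {(eval s (bracket a b), bracket a b)}
      (formalLetters s A fun c => 𝔴.weight (bracket a b) < 𝔴.weight c) (y * z)
      (2 * C * Real.exp (2 * C) * (2 * C * Real.exp (2 * C))) g ∧ Reach s' 𝔉' (4 * C) R g := by
  have hφ := 𝔉.isSize hR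
  have pw : ∀ (a : FormalComm k) (y : ℕ) (e : G), y ≤ C * 𝔉.comm a R →
      Coll (fun c => 𝔉.comm c R) ∅
        (formalLetters s A fun c => 𝔴.weight a < 𝔴.weight c) 0 C e →
      Coll (fun c => 𝔉.comm c R) {(eval s a, a)}
        (formalLetters s A fun c => 𝔴.weight a < 𝔴.weight c) y (2 * C) (eval s a ^ y * e) := by
    intro a y e hy he
    have h1 := (Coll.mark_one (φ := fun c => 𝔉.comm c R)
      (U := formalLetters s A fun c => 𝔴.weight a < 𝔴.weight c)
      (Set.mem_singleton (eval s a, a))).pow y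
    have h2 := h1.mul (he.subset (Set.empty_subset _) le_rfl)
    rw [mul_one, add_zero] at h2
    refine h2.mono ?_
    have : (y : ℝ) * (𝔉.comm a R)⁻¹ ≤ C := by
      rw [← div_eq_mul_inv, div_le_iff₀ (hφ.pos a)]; exact hy
    change (y : ℝ) * (𝔉.comm a R)⁻¹ + C ≤ 2 * C
    linarith
  have mem : ∀ {a : FormalComm k}, a.letters ⊆ A → ∀ x ∈
      ({(eval s a, a)} : Set (G × FormalComm k)) ∪
      formalLetters s A (fun c => 𝔴.weight a < 𝔴.weight c),
      x ∈ formalLetters s A fun c => 𝔴.weight a ≤ 𝔴.weight c := by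
    rintro a ha x (rfl | hx)
    · exact ⟨rfl, ha, le_rfl⟩
    · exact ⟨hx.1, hx.2.1, hx.2.2.le⟩
  have hab : (bracket a b).letters ⊆ A := Set.union_subset ha hb
  -- The group commutator uses each of its two entries and their inverses once, hence the constant
  -- 4C.
  refine ⟨_, Coll.comm hφ (pw a y e hy he) (pw b z f hz hf) ?_ ?_ ?_ ?_ ?_,
    (((hra.inv.mul hrb.inv).mul hra).mul hrb).mono hR (by linarith)⟩
  · rintro _ rfl _ rfl; rfl
  · rintro _ rfl y hy
    exact br_mem_formalLetters (mem ha _ (Or.inl rfl)) hy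
      fun h h' => add_lt_add_of_le_of_lt h h'
  · rintro x hx y hy
    exact br_mem_formalLetters hx (mem hb y hy) fun h h' => add_lt_add_of_lt_of_le h h'
  · rintro x hx y hy
    exact br_mem_formalLetters (mem hab x hx) (mem ha y hy) fun h _ =>
      h.trans_lt (𝔴.weight_lt_bracket_left _ _)
  · rintro x hx y hy
    exact br_mem_formalLetters (mem hab x hx) (mem hb y hy) fun h _ =>
      h.trans_lt (𝔴.weight_lt_bracket_left _ _)

/-- For a bracket, x is divided by m = ⌊F_a(R)⌋. Then [a^m,b^q] and [a^r,b] supply the exponents mq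
and r, with q = O(F_b(R)) and r ≤ F_a(R), so the induction hypotheses apply to the powers of a and
b. -/
theorem exists_pow_error
    (hA : ∀ i ∈ A, ∀ M, UReach s' 𝔉' fun R g => ∃ x : ℕ, x ≤ M * 𝔉.F i R ∧ g = s i ^ x)
    (c : FormalComm k) (hc : c.letters ⊆ A) (M : ℝ) :
    ∃ C, ∀ R, 1 ≤ R → ∀ x : ℕ, x ≤ M * 𝔉.comm c R → ∃ e,
      Coll (fun c => 𝔉.comm c R) ∅
        (formalLetters s A fun c' => 𝔴.weight c < 𝔴.weight c') 0 C e ∧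
      Reach s' 𝔉' C R (eval s c ^ x * e) := by
  induction c generalizing M with
  | letter i ε =>
    obtain ⟨C, hC⟩ := hA i (hc rfl) M
    refine ⟨max C 0, fun R hR x hx => ⟨1, Coll.one.mono (le_max_right _ _), ?_⟩⟩
    have h := (hC R hR (s i ^ x) ⟨x, hx, rfl⟩).mono hR (le_max_left C 0)
    rw [mul_one]
    cases ε
    · simpa [eval] using h.inv
    · simpa [eval] using h
  | bracket a b iha ihb =>
    have ha : a.letters ⊆ A := Set.subset_union_left.trans hc
    have hb : b.letters ⊆ A := Set.subset_union_right.trans hc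
    set M₀ := max M 1 with hM₀
    have hM₀1 : 1 ≤ M₀ := le_max_right _ _
    obtain ⟨C₁, hC₁⟩ := iha ha 1
    obtain ⟨C₂, hC₂⟩ := ihb hb (2 * M₀)
    set C := max (max C₁ C₂) (2 * M₀) with hCdef
    have hCC₁ : C₁ ≤ C := (le_max_left _ _).trans (le_max_left _ _)
    have hCC₂ : C₂ ≤ C := (le_max_right _ _).trans (le_max_left _ _)
    have hCM : 2 * M₀ ≤ C := le_max_right _ _
    have hC0 : 0 ≤ C := by linarith
    set L := 2 * C * Real.exp (2 * C) * (2 * C * Real.exp (2 * C)) with hL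
    refine ⟨max ((L + L) * Real.exp (L + L)) (8 * C), fun R hR x hx => ?_⟩
    have hφ := 𝔉.isSize hR
    have ha1 : 1 ≤ 𝔉.comm a R := hφ.one_le a
    have hb1 : 1 ≤ 𝔉.comm b R := hφ.one_le b
    have hx' : (x : ℝ) ≤ M * (𝔉.comm a R * 𝔉.comm b R) := hx
    set m := ⌊𝔉.comm a R⌋₊ with hm
    have hm1 : 1 ≤ m := Nat.le_floor (by simpa using ha1)
    have hmle : (m : ℝ) ≤ 𝔉.comm a R := Nat.floor_le (by linarith)
    have hm2 : 𝔉.comm a R ≤ 2 * m := by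
      have := Nat.lt_floor_add_one (𝔉.comm a R)
      have : (1 : ℝ) ≤ m := by exact_mod_cast hm1
      linarith
    have hq : ((x / m : ℕ) : ℝ) ≤ 2 * M₀ * 𝔉.comm b R := by
      have hm0 : (0 : ℝ) < m := by exact_mod_cast hm1
      refine Nat.cast_div_le.trans ?_
      rw [div_le_iff₀ hm0]
      have h1 : M * (𝔉.comm a R * 𝔉.comm b R) ≤ M₀ * (𝔉.comm a R * 𝔉.comm b R) := by
        have : M ≤ M₀ := le_max_left _ _
        gcongr
      have h2 : M₀ * (𝔉.comm a R * 𝔉.comm b R) ≤ M₀ * (2 * m * 𝔉.comm b R) := by gcongr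
      linarith
    have hr : ((x % m : ℕ) : ℝ) ≤ 𝔉.comm a R :=
      le_trans (by exact_mod_cast (Nat.mod_lt x hm1).le) hmle
    have fill : ∀ c : FormalComm k, 1 ≤ 𝔉.comm c R → ∀ y : ℝ, y ≤ 2 * M₀ * 𝔉.comm c R →
        y ≤ C * 𝔉.comm c R := fun c h1 y hy => hy.trans (by gcongr)
    have one_fill : ∀ c : FormalComm k, 1 ≤ 𝔉.comm c R → ∀ y : ℝ, y ≤ 𝔉.comm c R →
        y ≤ 2 * M₀ * 𝔉.comm c R := fun c h1 y hy => hy.trans (by nlinarith)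
    have step : ∀ y z : ℕ, (y : ℝ) ≤ 𝔉.comm a R → (z : ℝ) ≤ 2 * M₀ * 𝔉.comm b R →
        ∃ g, Coll (fun c => 𝔉.comm c R) {(eval s (bracket a b), bracket a b)}
          (formalLetters s A fun c => 𝔴.weight (bracket a b) < 𝔴.weight c) (y * z) L g ∧
          Reach s' 𝔉' (4 * C) R g := by
      intro y z hy hz
      obtain ⟨e, he, hre⟩ := hC₁ R hR y (by linarith)
      obtain ⟨f, hf, hrf⟩ := hC₂ R hR z hz
      exact bracket_pow_error ha hb hR (fill a ha1 _ (one_fill a ha1 _ hy)) (fill b hb1 _ hz)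
        (he.mono hCC₁) (hf.mono hCC₂) (hre.mono hR hCC₁) (hrf.mono hR hCC₂)
    obtain ⟨g₁, hg₁, hr₁⟩ := step m (x / m) hmle hq
    obtain ⟨g₂, hg₂, hr₂⟩ := step (x % m) 1 hr (one_fill b hb1 _ (by simpa using hb1))
    have h := hg₁.mul hg₂
    rw [mul_one, Nat.div_add_mod] at h
    obtain ⟨-, e, he, hce⟩ := h.gather hφ fun u hu =>
      br_mem_formalLetters (q := fun _ => True) (r := fun c => 𝔴.weight (bracket a b) < 𝔴.weight c)
        hu ⟨rfl, hc, trivial⟩ fun h _ => h.trans (𝔴.weight_lt_bracket_left _ _)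
    refine ⟨e, hce.mono (le_max_left _ _), ?_⟩
    have h2 := hr₁.mul hr₂
    rw [he] at h2
    exact h2.mono hR (le_trans (by linarith) (le_max_right _ _))

/-- Descending induction on the level: a power of a commutator is reached up to an error of bounded
cost in heavier commutators, and that error is itself reached. -/
theorem uReach_formalLetters [NeZero k] [Group.IsNilpotent G]
    (hA : ∀ i ∈ A, ∀ M, UReach s' 𝔉' fun R g => ∃ x : ℕ, x ≤ M * 𝔉.F i R ∧ g = s i ^ x)
    (j : ℕ) (M : ℝ) :
    UReach s' 𝔉' fun R g => Coll (fun c => 𝔉.comm c R) ∅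
      (formalLetters s A fun c => 𝔴.wbar j ≤ 𝔴.weight c) 0 M g := by
  obtain ⟨J, hJ⟩ := exists_eval_eq_one s 𝔴
  have base : ∀ j, J ≤ j → ∀ M, UReach s' 𝔉' fun R g => Coll (fun c => 𝔉.comm c R) ∅
      (formalLetters s A fun c => 𝔴.wbar j ≤ 𝔴.weight c) 0 M g := by
    refine fun j hj M => ⟨0, fun R hR g hg => ?_⟩
    have : g ∈ (⊥ : Subgroup G) := hg.mem_subgroup (by simp) fun a ha => by
      rw [Subgroup.mem_bot, ha.1, hJ _ ((𝔴.wbar_strictMono.monotone hj).trans ha.2.2)]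
    rw [Subgroup.mem_bot.1 this]
    exact Reach.one
  rcases le_total J j with h | h
  · exact base j h M
  induction h using Nat.decreasingInduction generalizing M with
  | self => exact base J le_rfl M
  | of_succ j _ ih =>
    have hfin : (formalLetters s A fun c => 𝔴.weight c = 𝔴.wbar j).Finite := by
      refine ((𝔴.finite_weight_lt (j + 1)).image fun c => (eval s c, c)).subset ?_
      rintro ⟨g, c⟩ ⟨hg, -, h⟩
      obtain rfl : g = eval s c := hg
      exact ⟨c, (le_of_eq h).trans_lt (𝔴.wbar_strictMono j.lt_succ_self), rfl⟩
    have hcl : ∀ a ∈ formalLetters s A (fun c => 𝔴.wbar j ≤ 𝔴.weight c),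
        ∀ b ∈ formalLetters s A (fun c => 𝔴.weight c = 𝔴.wbar j),
        br a b ∈ formalLetters s A (fun c => 𝔴.wbar (j + 1) ≤ 𝔴.weight c) := fun a ha b hb =>
      br_mem_formalLetters ha hb fun h _ =>
        𝔴.wbar_succ_le (h.trans_lt (𝔴.weight_lt_bracket_left _ _))
    have key := uReach_of_gather hfin.toFinset
      (formalLetters s A fun c => 𝔴.wbar (j + 1) ≤ 𝔴.weight c) (𝔉 := 𝔉) (s' := s') (𝔉' := 𝔉')
      ?_ ?_ ih M
    · refine key.of_imp fun R _ g hg => hg.subset le_rfl ?_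
      rintro a ⟨ha, hA, hw⟩
      rcases hw.lt_or_eq with hw | hw
      · exact Or.inr ⟨ha, hA, 𝔴.wbar_succ_le hw⟩
      · exact Or.inl (by rw [Set.Finite.coe_toFinset]; exact ⟨ha, hA, hw.symm⟩)
    · rintro a ha b hb
      refine hcl a ?_ b (hfin.mem_toFinset.1 hb)
      rcases ha with ha | ha
      · rw [Set.Finite.coe_toFinset] at ha
        exact ⟨ha.1, ha.2.1, ha.2.2.ge⟩
      · exact ⟨ha.1, ha.2.1, (𝔴.wbar_strictMono j.lt_succ_self).le.trans ha.2.2⟩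
    · intro a ha M
      obtain ⟨ha, hcA, hw⟩ := hfin.mem_toFinset.1 ha
      obtain ⟨C, hC⟩ := exists_pow_error (𝔴 := 𝔴) hA a.2 hcA M
      obtain ⟨C', hC'⟩ := ih C
      refine ⟨C + C', ?_⟩
      rintro R hR _ ⟨x, hx, rfl⟩
      obtain ⟨e, he, hr⟩ := hC R hR x hx
      have h1 := hC' R hR e (he.subset le_rfl fun u hu =>
        ⟨hu.1, hu.2.1, 𝔴.wbar_succ_le (hw ▸ hu.2.2)⟩)
      have h2 := hr.mul h1.inv
      rwa [mul_inv_cancel_right, ← ha] at h2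

theorem uReach_pow [NeZero k] [Group.IsNilpotent G] (𝔴 : WeightSystem k d)
    (hA : ∀ i ∈ A, ∀ M, UReach s' 𝔉' fun R g => ∃ x : ℕ, x ≤ M * 𝔉.F i R ∧ g = s i ^ x)
    (c : FormalComm k) (hc : c.letters ⊆ A) (M : ℝ) :
    UReach s' 𝔉' fun R g => ∃ x : ℕ, x ≤ M * 𝔉.comm c R ∧ g = eval s c ^ x := by
  refine (uReach_formalLetters (𝔴 := 𝔴) hA 0 M).of_imp ?_
  rintro R hR _ ⟨x, hx, rfl⟩
  have h := (Coll.cons_one (φ := fun c => 𝔉.comm c R) (D := ∅) (a := (eval s c, c))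
    (U := formalLetters s A fun c => 𝔴.wbar 0 ≤ 𝔴.weight c) ⟨rfl, hc, 𝔴.wbar_zero_le c⟩).pow x
  refine h.mono ?_
  change (x : ℝ) * (𝔉.comm c R)⁻¹ ≤ M
  rw [← div_eq_mul_inv, div_le_iff₀ ((𝔉.isSize hR).pos c)]
  exact hx

end FormalLetters

/-- By (F2), a heavier letter costs at most a constant times a lighter one, uniformly in the scale.
-/
theorem WeightFunctions.Compatible.inv_comm_le {k d : ℕ} {𝔉 : WeightFunctions k}
    {𝔴 : WeightSystem k d} (h : 𝔉.Compatible 𝔴) {c c' : FormalComm k}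
    (hw : 𝔴.weight c ≤ 𝔴.weight c') :
    ∃ C, ∀ R, 1 ≤ R → (𝔉.comm c' R)⁻¹ ≤ C * (𝔉.comm c R)⁻¹ := by
  obtain ⟨C, -, hC⟩ := (h c c').1 hw
  refine ⟨C, fun R hR => ?_⟩
  have h1 := (𝔉.isSize hR).pos c
  have h2 := (𝔉.isSize hR).pos c'
  change 0 < 𝔉.comm c R at h1
  change 0 < 𝔉.comm c' R at h2
  rw [← div_eq_mul_inv, le_div_iff₀ h1, ← div_eq_inv_mul, div_le_iff₀ h2]
  exact hC R hR

theorem FormalComm.letters_inv {k : ℕ} (c : FormalComm k) : c.inv.letters = c.letters := by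
  cases c with
  | letter i ε => rfl
  | bracket a b => exact Set.union_comm _ _

/-! ### Words in admissible letters -/

section Admissible

variable {G : Type*} [Group G] {k k' d : ℕ} {s : Fin k → G} {𝔴 : WeightSystem k d}
  {𝔉 : WeightFunctions k} {s' : Fin k' → G} {𝔉' : WeightFunctions k'}
  {t : ℕ} {cs : Fin t → FormalComm k}

variable (s 𝔴 cs) in
/-- The free members of weight `wbar j` of an adapted tuple and their formal inverses, as labels
of their images. -/
def freeLetters (j : ℕ) : Set (G × FormalComm k) :=
  {a | ∃ i ∈ freeIndices s 𝔴 cs j, a = (eval s (cs i), cs i) ∨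
    a = (eval s (cs i).inv, (cs i).inv)}

theorem finite_freeLetters (j : ℕ) : (freeLetters s 𝔴 cs j).Finite := by
  refine ((Set.finite_range fun i => (eval s (cs i), cs i)).union
    (Set.finite_range fun i => (eval s (cs i).inv, (cs i).inv))).subset ?_
  rintro _ ⟨i, -, rfl | rfl⟩
  · exact Or.inl ⟨i, rfl⟩
  · exact Or.inr ⟨i, rfl⟩

theorem freeLetters_spec {j : ℕ} {a : G × FormalComm k} (ha : a ∈ freeLetters s 𝔴 cs j) :
    a.1 = eval s a.2 ∧ 𝔴.weight a.2 = 𝔴.wbar j ∧ a.2.letters ⊆ core s 𝔴 cs := by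
  obtain ⟨i, hi, rfl | rfl⟩ := ha
  · exact ⟨rfl, hi.1, fun δ hδ => ⟨j, i, hi, hδ⟩⟩
  · exact ⟨rfl, (𝔴.weight_inv _).trans hi.1, fun δ hδ => ⟨j, i, hi, by
      rwa [FormalComm.letters_inv] at hδ⟩⟩

omit [Group G] in
theorem FiniteBelow.of_finite {A : Set (G × FormalComm k)} (hA : A.Finite) : FiniteBelow 𝔴 A :=
  fun _ => hA.subset fun _ h => h.1

/-- A fixed word in free letters of the level costs O(1/F_c(R)), so its powers with exponent
O(F_c(R)) have bounded cost. Words in `Coll` are positive, which is why `freeLetters` contains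
formal inverses. -/
theorem exists_coll_of_mem_closure (hcomp : 𝔉.Compatible 𝔴) {j : ℕ} {c : FormalComm k}
    (hc : 𝔴.weight c = 𝔴.wbar j) {p : G}
    (hp : p ∈ Subgroup.closure (Set.range fun i : freeIndices s 𝔴 cs j => eval s (cs i))) :
    ∃ C, ∀ R, 1 ≤ R → Coll (fun c => 𝔉.comm c R) ∅ (freeLetters s 𝔴 cs j) 0
      (C * (𝔉.comm c R)⁻¹) p := by
  have key : ∀ a ∈ freeLetters s 𝔴 cs j, ∃ C, ∀ R, 1 ≤ R →
      Coll (fun c => 𝔉.comm c R) ∅ (freeLetters s 𝔴 cs j) 0 (C * (𝔉.comm c R)⁻¹) a.1 := by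
    intro a ha
    obtain ⟨C, hC⟩ := hcomp.inv_comm_le (hc.trans (freeLetters_spec ha).2.1.symm).le
    exact ⟨C, fun R hR => (Coll.cons_one ha).mono (hC R hR)⟩
  have keymul : ∀ {x y : G} {C C' : ℝ}, (∀ R, 1 ≤ R → Coll (fun c => 𝔉.comm c R) ∅
      (freeLetters s 𝔴 cs j) 0 (C * (𝔉.comm c R)⁻¹) x) → (∀ R, 1 ≤ R →
      Coll (fun c => 𝔉.comm c R) ∅ (freeLetters s 𝔴 cs j) 0 (C' * (𝔉.comm c R)⁻¹) y) →
      ∀ R, 1 ≤ R → Coll (fun c => 𝔉.comm c R) ∅ (freeLetters s 𝔴 cs j) 0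
        ((C + C') * (𝔉.comm c R)⁻¹) (x * y) := by
    intro x y C C' hx hy R hR
    rw [add_mul]
    exact (hx R hR).mul (hy R hR)
  have one : ∀ R, 1 ≤ R → Coll (fun c => 𝔉.comm c R) ∅ (freeLetters s 𝔴 cs j) 0
      (0 * (𝔉.comm c R)⁻¹) (1 : G) := fun R _ => by rw [zero_mul]; exact Coll.one
  induction hp using Subgroup.closure_induction'' with
  | mem x hx =>
    obtain ⟨⟨i, hi⟩, rfl⟩ := hx
    exact key (eval s (cs i), cs i) ⟨i, hi, Or.inl rfl⟩
  | inv_mem x hx =>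
    obtain ⟨⟨i, hi⟩, rfl⟩ := hx
    have := key (eval s (cs i).inv, (cs i).inv) ⟨i, hi, Or.inr rfl⟩
    simpa only [eval_inv] using this
  | one => exact ⟨0, one⟩
  | mul x y _ _ hx hy => exact ⟨_, keymul hx.choose_spec hy.choose_spec⟩

variable [NeZero k] [Group.IsNilpotent G]

variable (s 𝔴 𝔉 s' 𝔉') in
/-- Admissible words with letters of weight at least `wbar j` are reached uniformly. -/
def LevelReach (j : ℕ) : Prop :=
  ∀ A : Set (G × FormalComm k), (∀ a ∈ A, Admissible s 𝔴 a) → (∀ a ∈ A, 𝔴.wbar j ≤ 𝔴.weight a.2) →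
    FiniteBelow 𝔴 A → ∀ M,
      UReach s' 𝔉' fun R g => Coll (fun c => 𝔉.comm c R) ∅ A 0 M g

/-- Collecting the letters of weight `wbar j` leaves brackets of higher weight, possibly infinitely
many; `LevelReach` therefore asks only for finitely many labels below each level. -/
theorem uReach_of_level {j : ℕ} (hs : Subgroup.closure (Set.range s) = ⊤)
    (ih : LevelReach s 𝔴 𝔉 s' 𝔉' (j + 1)) {D A : Set (G × FormalComm k)} (hDf : D.Finite)
    (hDA : ∀ a ∈ A, a ∈ D ∨ 𝔴.wbar (j + 1) ≤ 𝔴.weight a.2) (hDA' : D ⊆ A)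
    (hDw : ∀ a ∈ D, 𝔴.weight a.2 = 𝔴.wbar j)
    (hA : ∀ a ∈ A, Admissible s 𝔴 a) (hAf : FiniteBelow 𝔴 A)
    (hD : ∀ d ∈ D, ∀ M, UReach s' 𝔉' fun R g => ∃ x : ℕ, x ≤ M * 𝔉.comm d.2 R ∧ g = d.1 ^ x)
    (M : ℝ) : UReach s' 𝔉' fun R g => Coll (fun c => 𝔉.comm c R) ∅ A 0 M g := by
  set U : Set (G × FormalComm k) := {a | BrClosure A a ∧ 𝔴.wbar (j + 1) ≤ 𝔴.weight a.2} with hU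
  have hw : ∀ a ∈ D ∪ U, 𝔴.wbar j ≤ 𝔴.weight a.2 := by
    rintro a (ha | ha)
    · exact (hDw a ha).ge
    · exact (𝔴.wbar_strictMono j.lt_succ_self).le.trans ha.2
  have hb : ∀ a ∈ D ∪ U, BrClosure A a := by
    rintro a (ha | ha)
    · exact .base (hDA' ha)
    · exact ha.1
  refine (uReach_of_gather hDf.toFinset U (𝔉 := 𝔉) (s' := s') (𝔉' := 𝔉') ?_ ?_ ?_ M).of_imp
    fun R _ g hg => hg.subset le_rfl fun a ha => ?_
  · intro a ha b hb'
    rw [Set.Finite.coe_toFinset] at ha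
    exact ⟨(hb a ha).br (.base (hDA' (hDf.mem_toFinset.1 hb'))),
      𝔴.wbar_succ_le ((hw a ha).trans_lt (𝔴.weight_lt_bracket_left _ _))⟩
  · exact fun d hd => hD d (hDf.mem_toFinset.1 hd)
  · refine ih U (fun a ha => ha.1.admissible hs hA) (fun a ha => ha.2) fun i => ?_
    exact (hAf.brClosure i).subset fun a ha => ⟨ha.1.1, ha.2⟩
  · rw [Set.Finite.coe_toFinset]
    exact (hDA a ha).imp id fun h => ⟨.base ha, h⟩

/-- Some power a^(uN) is p·h with p a product of free commutators and inverses, and h in the next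
filtration term. The exponent is divided by uN: the remainder gives finitely many elements, and the
quotient gives a word of bounded cost in free letters and h. -/
theorem uReach_pow_admissible {j : ℕ} (hs : Subgroup.closure (Set.range s) = ⊤)
    (hs' : Subgroup.closure (Set.range s') = ⊤) (hcs : IsAdapted s 𝔴 cs)
    (hcomp : 𝔉.Compatible 𝔴)
    (hcore : ∀ i ∈ core s 𝔴 cs, ∀ M,
      UReach s' 𝔉' fun R g => ∃ x : ℕ, x ≤ M * 𝔉.F i R ∧ g = s i ^ x)
    (ih : LevelReach s 𝔴 𝔉 s' 𝔉' (j + 1)) {a : G × FormalComm k} (ha : Admissible s 𝔴 a)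
    (hw : 𝔴.weight a.2 = 𝔴.wbar j) (M : ℝ) :
    UReach s' 𝔉' fun R g => ∃ x : ℕ, x ≤ M * 𝔉.comm a.2 R ∧ g = a.1 ^ x := by
  obtain ⟨u, hu, hau⟩ := ha
  rw [hw] at hau
  obtain ⟨N, hN, p, hp, h, hh, e⟩ := exists_pow_mem_closure_free hcs j hau
  rw [← pow_mul] at e
  have huN : 0 < u * N := Nat.mul_pos hu hN
  -- Any commutator of the next level can label h, since admissibility sees only the weight of the
  -- label.
  obtain ⟨c, hc⟩ := 𝔴.wbar_mem_range (j + 1)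
  obtain ⟨C₁, hC₁⟩ := exists_coll_of_mem_closure (𝔉 := 𝔉) hcomp hw hp
  obtain ⟨C₂, hC₂⟩ := hcomp.inv_comm_le (c := a.2) (c' := c)
    (by rw [hw, hc]; exact (𝔴.wbar_strictMono j.lt_succ_self).le)
  set A : Set (G × FormalComm k) := freeLetters s 𝔴 cs j ∪ {(h, c)} with hA
  have hAfin : A.Finite := (finite_freeLetters j).union (Set.finite_singleton _)
  have hcoll : ∀ R, 1 ≤ R → Coll (fun c => 𝔉.comm c R) ∅ A 0
      ((C₁ + C₂) * (𝔉.comm a.2 R)⁻¹) (a.1 ^ (u * N)) := by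
    intro R hR
    rw [e, add_mul]
    refine Coll.mul (n := 0) (n' := 0) ((hC₁ R hR).subset le_rfl Set.subset_union_left) ?_
    exact (Coll.cons_one (a := (h, c)) (Or.inr rfl)).mono (hC₂ R hR)
  have hmain := uReach_of_level (𝔉 := 𝔉) hs ih (finite_freeLetters (s := s) (𝔴 := 𝔴) (cs := cs) j)
    (A := A) ?_ Set.subset_union_left (fun a ha => (freeLetters_spec ha).2.1) ?_
    (FiniteBelow.of_finite hAfin) ?_ (|M| * |C₁ + C₂|)
  · refine UReach.mul (uReach_of_finite hs' (Set.finite_range fun r : Fin (u * N) => a.1 ^ (r : ℕ)))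
      hmain ?_
    rintro R hR _ ⟨x, hx, rfl⟩
    refine ⟨a.1 ^ (x % (u * N)), (a.1 ^ (u * N)) ^ (x / (u * N)),
      ⟨⟨_, Nat.mod_lt x huN⟩, rfl⟩, ((hcoll R hR).pow _).mono ?_, ?_⟩
    · have h0 : 0 < 𝔉.comm a.2 R := (𝔉.isSize hR).pos a.2
      have h1 : ((x / (u * N) : ℕ) : ℝ) ≤ x := by exact_mod_cast Nat.div_le_self _ _
      have h2 : (x : ℝ) * (𝔉.comm a.2 R)⁻¹ ≤ |M| := by
        rw [← div_eq_mul_inv, div_le_iff₀ h0]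
        exact hx.trans (mul_le_mul_of_nonneg_right (le_abs_self M) h0.le)
      calc ((x / (u * N) : ℕ) : ℝ) * ((C₁ + C₂) * (𝔉.comm a.2 R)⁻¹)
          ≤ x * (|C₁ + C₂| * (𝔉.comm a.2 R)⁻¹) := by
            have h3 : (C₁ + C₂) * (𝔉.comm a.2 R)⁻¹ ≤ |C₁ + C₂| * (𝔉.comm a.2 R)⁻¹ :=
              mul_le_mul_of_nonneg_right (le_abs_self _) (inv_nonneg.2 h0.le)
            exact mul_le_mul h1 h3 ((hcoll R hR).nonneg (𝔉.isSize hR)) (Nat.cast_nonneg _)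
        _ = (x * (𝔉.comm a.2 R)⁻¹) * |C₁ + C₂| := by ring
        _ ≤ |M| * |C₁ + C₂| := mul_le_mul_of_nonneg_right h2 (abs_nonneg _)
    · rw [← pow_mul, ← pow_add, Nat.mod_add_div]
  · rintro b (hb | rfl)
    · exact Or.inl hb
    · exact Or.inr hc.ge
  · rintro b (hb | rfl)
    · refine ⟨1, one_pos, ?_⟩
      rw [pow_one, (freeLetters_spec hb).1]
      exact eval_mem_filtGE le_rfl
    · refine ⟨1, one_pos, ?_⟩
      rw [pow_one]
      change h ∈ filtGE s 𝔴 (𝔴.weight c)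
      rw [hc]
      exact hh
  · intro b hb M
    obtain ⟨h1, -, h3⟩ := freeLetters_spec hb
    rw [h1]
    exact uReach_pow 𝔴 hcore b.2 h3 M

theorem levelReach (hs : Subgroup.closure (Set.range s) = ⊤)
    (hs' : Subgroup.closure (Set.range s') = ⊤) (hcs : IsAdapted s 𝔴 cs)
    (hcomp : 𝔉.Compatible 𝔴)
    (hcore : ∀ i ∈ core s 𝔴 cs, ∀ M,
      UReach s' 𝔉' fun R g => ∃ x : ℕ, x ≤ M * 𝔉.F i R ∧ g = s i ^ x) :
    LevelReach s 𝔴 𝔉 s' 𝔉' 0 := by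
  obtain ⟨J, hJ⟩ := exists_filt_eq_bot (s := s) (𝔴 := 𝔴)
  refine Nat.decreasingInduction (motive := fun j _ => LevelReach s 𝔴 𝔉 s' 𝔉' j) ?_ ?_ J.zero_le
  · intro j _ ih A hA hAw hAf M
    refine uReach_of_level hs ih (D := {a ∈ A | 𝔴.weight a.2 < 𝔴.wbar (j + 1)}) (hAf _)
      (fun a ha => ?_) (fun a ha => ha.1)
      (fun a ha => le_antisymm (𝔴.weight_le_wbar ha.2) (hAw a ha.1)) hA hAf (fun a ha M => ?_) M
    · rcases lt_or_ge (𝔴.weight a.2) (𝔴.wbar (j + 1)) with h | h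
      · exact Or.inl ⟨ha, h⟩
      · exact Or.inr h
    · exact uReach_pow_admissible hs hs' hcs hcomp hcore ih (hA a ha.1)
        (le_antisymm (𝔴.weight_le_wbar ha.2) (hAw a ha.1)) M
  · intro A hA hAw _ M
    -- At the trivial term of the filtration, admissible letters are torsion, so all their products
    -- lie in one finite set.
    refine (uReach_of_finite hs' (finite_isOfFinOrder hs hcs)).of_imp fun R _ g hg => ?_
    refine hg.mem_subgroup (H := torsionSubgroup G) (by simp) fun a ha => ?_
    obtain ⟨u, hu, hau⟩ := hA a ha
    have : a.1 ^ u ∈ filt s 𝔴 J := filtGE_antitone (hAw a ha) hau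
    rw [hJ, Subgroup.mem_bot] at this
    exact isOfFinOrder_iff_pow_eq_one.2 ⟨u, hu, this⟩

end Admissible

/-! ### Generalized inverses of doubling functions -/

section GenInv

variable {f : ℝ → ℝ} {D : ℝ}

theorem genInv_le {x r : ℝ} (hr : 1 ≤ r) (hx : x ≤ f r) : genInv f x ≤ r := by
  rw [genInv]
  split_ifs
  · linarith
  · exact csInf_le ⟨1, fun _ h => h.1⟩ ⟨hr, hx⟩

theorem pow_mul_le (hD : 1 ≤ D) (hf : ∀ r, 1 ≤ r → 2 * f r ≤ f (D * r)) (n : ℕ) {r : ℝ}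
    (hr : 1 ≤ r) : 2 ^ n * f r ≤ f (D ^ n * r) := by
  induction n with
  | zero => simp
  | succ n ih =>
    have h1 : 1 ≤ D ^ n * r := one_le_mul_of_one_le_of_one_le (one_le_pow₀ hD) hr
    have h2 := hf _ h1
    rw [← mul_assoc, ← pow_succ'] at h2
    rw [pow_succ']
    linarith

theorem exists_le_of_doubling (hD : 1 ≤ D) (hf : ∀ r, 1 ≤ r → 2 * f r ≤ f (D * r))
    (h1 : ∀ r, 1 ≤ r → 1 ≤ f r) (x : ℝ) : ∃ r, 1 ≤ r ∧ x ≤ f r := by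
  obtain ⟨n, hn⟩ := pow_unbounded_of_one_lt x one_lt_two
  refine ⟨D ^ n * 1, by simpa using one_le_pow₀ hD, ?_⟩
  have h2 := pow_mul_le hD hf n le_rfl
  have h3 := h1 1 le_rfl
  have h4 : (0 : ℝ) < 2 ^ n := by positivity
  nlinarith

theorem le_genInv (hne : ∀ x, ∃ r, 1 ≤ r ∧ x ≤ f r) {x r : ℝ} (hx : 0 < x)
    (h : ∀ r', 1 ≤ r' → x ≤ f r' → r ≤ r') : r ≤ genInv f x := by
  rw [genInv, if_neg hx.not_ge]
  exact le_csInf (hne x) fun r' hr' => h r' hr'.1 hr'.2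

theorem genInv_mono (hne : ∀ x, ∃ r, 1 ≤ r ∧ x ≤ f r) {x y : ℝ} (hy : 0 < y) (hxy : x ≤ y) :
    genInv f x ≤ genInv f y :=
  le_genInv hne hy fun _ h1 h2 => genInv_le h1 (hxy.trans h2)

theorem genInv_two_mul_le (hD : 1 ≤ D) (hf : ∀ r, 1 ≤ r → 2 * f r ≤ f (D * r))
    (hne : ∀ x, ∃ r, 1 ≤ r ∧ x ≤ f r) {x : ℝ} (hx : 0 < x) :
    genInv f (2 * x) ≤ D * genInv f x := by
  have hD0 : 0 < D := by linarith
  rw [← div_le_iff₀' hD0]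
  refine le_genInv hne hx fun r h1 h2 => ?_
  rw [div_le_iff₀' hD0]
  exact genInv_le (one_le_mul_of_one_le_of_one_le hD h1) (by linarith [hf r h1])

/-- A monotone f may have plateaus, so f(R) does not determine R; but f(DR) ≥ 2f(R) > f(R) excludes
preimages below R. -/
theorem le_genInv_apply (hf : ∀ r, 1 ≤ r → 2 * f r ≤ f (D * r))
    (hne : ∀ x, ∃ r, 1 ≤ r ∧ x ≤ f r) (hm : MonotoneOn f (Set.Ici 1))
    (h1 : ∀ r, 1 ≤ r → 1 ≤ f r) {R : ℝ} (hR : 1 ≤ R) : R ≤ genInv f (f (D * R)) := by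
  have h2 := hf R hR
  have h3 := h1 R hR
  refine le_genInv hne (by linarith) fun r' hr' h => ?_
  by_contra! hlt
  have := hm (Set.mem_Ici.2 hr') (Set.mem_Ici.2 hR) hlt.le
  linarith

end GenInv

/-! ### The normalized quasi-norm in terms of words -/

section Norm

variable {G : Type*} [Group G] {k : ℕ} {s : Fin k → G} {𝔉 : WeightFunctions k}

theorem normalized_one (i₀ : Fin k) : normalized s 𝔉 i₀ 1 = 0 := by
  simp [normalized, qnorm, genInv]

theorem length_le_sum_deg (ω : List (Fin k × Bool)) : ω.length ≤ ∑ i, deg i ω := by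
  induction ω with
  | nil => simp
  | cons p ω ih =>
    have h : ∀ i, deg i (p :: ω) = deg i ω + if p.1 = i then 1 else 0 := by
      intro i; simp [deg, List.countP_cons]
    simp only [h, Finset.sum_add_distrib, Finset.sum_ite_eq, Finset.mem_univ, if_true,
      List.length_cons]
    omega

/-- With C ≤ 2^n, doubling absorbs C into the scale D^n·R; one further factor D comes from inverting
F_S. -/
theorem exists_normalized_le (hdoub : 𝔉.Doubling) (i₀ : Fin k) (C : ℝ) :
    ∃ C', 0 < C' ∧ ∀ R, 1 ≤ R → ∀ g, Reach s 𝔉 C R g → normalized s 𝔉 i₀ g ≤ C' * R := by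
  obtain ⟨D, hD, hdoub⟩ := hdoub
  obtain ⟨n, hn⟩ := pow_unbounded_of_one_lt C one_lt_two
  have hf := fun i r hr => (hdoub i r hr).1
  have hne := exists_le_of_doubling hD (hf i₀) (𝔉.one_le i₀)
  refine ⟨D * D ^ n, by positivity, fun R hR g ⟨ω, e, hω⟩ => ?_⟩
  rcases eq_or_ne g 1 with rfl | hg
  · rw [normalized_one]; positivity
  have hR1 : 1 ≤ D ^ n * R := one_le_mul_of_one_le_of_one_le (one_le_pow₀ hD) hR
  have hgen := le_genInv_apply (hf i₀) hne (𝔉.monotoneOn i₀) (𝔉.one_le i₀) hR1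
  have hDR : 1 ≤ D * (D ^ n * R) := one_le_mul_of_one_le_of_one_le hD hR1
  rw [mul_assoc]
  refine genInv_le hDR ?_
  rw [qnorm, if_neg hg]
  refine csInf_le ⟨1, fun _ h => h.1⟩ ⟨𝔉.one_le i₀ _ hDR, ω, e, fun i => ?_⟩
  refine (hω i).trans (le_trans ?_ (𝔉.monotoneOn i (Set.mem_Ici.2 hR1)
    (Set.mem_Ici.2 (hR1.trans hgen)) hgen))
  refine le_trans ?_ (pow_mul_le hD (hf i) n hR)
  have := 𝔉.one_le i R hR
  exact mul_le_mul_of_nonneg_right hn.le (by linarith)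

theorem exists_word_of_normalized (hs : Subgroup.closure (Set.range s) = ⊤) (hdoub : 𝔉.Doubling)
    (i₀ : Fin k) : ∃ C, 1 ≤ C ∧ ∀ g, g ≠ 1 → 1 ≤ normalized s 𝔉 i₀ g ∧
      ∃ ω, wordEval s ω = g ∧ ∀ i, (deg i ω : ℝ) ≤ 𝔉.F i (C * normalized s 𝔉 i₀ g) := by
  obtain ⟨D, hD, hdoub⟩ := hdoub
  have hf := fun i r hr => (hdoub i r hr).1
  have hne := exists_le_of_doubling hD (hf i₀) (𝔉.one_le i₀)
  refine ⟨D, hD, fun g hg => ?_⟩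
  set T := {r | 1 ≤ r ∧ ∃ ω, wordEval s ω = g ∧
      ∀ i, (deg i ω : ℝ) ≤ 𝔉.F i (genInv (𝔉.F i₀) r)} with hT
  -- Without this the infimum would take the default value 0.
  have hTne : T.Nonempty := by
    obtain ⟨ω, e⟩ := exists_wordEval hs g
    obtain ⟨n, hn⟩ := pow_unbounded_of_one_lt (ω.length : ℝ) one_lt_two
    have hR1 : 1 ≤ D ^ n * 1 := by simpa using one_le_pow₀ hD
    have hgen := le_genInv_apply (hf i₀) hne (𝔉.monotoneOn i₀) (𝔉.one_le i₀) hR1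
    refine ⟨_, 𝔉.one_le i₀ _ (one_le_mul_of_one_le_of_one_le hD hR1), ω, e, fun i => ?_⟩
    calc (deg i ω : ℝ) ≤ ω.length := by exact_mod_cast deg_le_length i ω
      _ ≤ 2 ^ n := hn.le
      _ ≤ 2 ^ n * 𝔉.F i 1 := le_mul_of_one_le_right (by positivity) (𝔉.one_le i 1 le_rfl)
      _ ≤ 𝔉.F i (D ^ n * 1) := pow_mul_le hD (hf i) n le_rfl
      _ ≤ _ := 𝔉.monotoneOn i (Set.mem_Ici.2 hR1) (Set.mem_Ici.2 (hR1.trans hgen)) hgen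
  have hq : qnorm s 𝔉 i₀ g = sInf T := by rw [qnorm, if_neg hg]
  have hq1 : 1 ≤ sInf T := le_csInf hTne fun r hr => hr.1
  have one_le : ∀ x, 0 < x → 1 ≤ genInv (𝔉.F i₀) x := fun x hx =>
    le_genInv hne hx fun _ h _ => h
  rw [normalized, hq]
  refine ⟨one_le _ (by linarith), ?_⟩
  -- The infimum need not be attained; a radius below twice the infimum suffices, because doubling
  -- the argument of the inverse costs only the factor D.
  obtain ⟨r, ⟨hr1, ω, e, hω⟩, hr⟩ := exists_lt_of_csInf_lt hTne
    (show sInf T < 2 * sInf T by linarith)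
  refine ⟨ω, e, fun i => (hω i).trans ?_⟩
  have h1 := one_le r (by linarith)
  have h2 := (genInv_mono hne (by linarith) hr.le).trans
    (genInv_two_mul_le hD (hf i₀) hne (show 0 < sInf T by linarith))
  exact 𝔉.monotoneOn i (Set.mem_Ici.2 h1) (Set.mem_Ici.2 (h1.trans h2)) h2

theorem finite_ball (hs : Subgroup.closure (Set.range s) = ⊤) (hdoub : 𝔉.Doubling)
    (i₀ : Fin k) (r : ℝ) : (ball s 𝔉 i₀ r).Finite := by
  obtain ⟨C, hC, h⟩ := exists_word_of_normalized hs hdoub i₀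
  refine ((Set.finite_singleton 1).union ((List.finite_length_le (Fin k × Bool)
    ⌊∑ i, 𝔉.F i (C * r)⌋₊).image (wordEval s))).subset fun g hg => ?_
  rcases eq_or_ne g 1 with rfl | hg1
  · exact Or.inl rfl
  obtain ⟨h1, ω, e, hω⟩ := h g hg1
  refine Or.inr ⟨ω, Nat.le_floor ?_, e⟩
  have hle : C * normalized s 𝔉 i₀ g ≤ C * r :=
    mul_le_mul_of_nonneg_left hg (by linarith)
  have h2 : 1 ≤ C * normalized s 𝔉 i₀ g := one_le_mul_of_one_le_of_one_le hC h1
  calc (ω.length : ℝ) ≤ ((∑ i, deg i ω : ℕ) : ℝ) := by exact_mod_cast length_le_sum_deg ω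
    _ = ∑ i, (deg i ω : ℝ) := by push_cast; rfl
    _ ≤ ∑ i, 𝔉.F i (C * r) := Finset.sum_le_sum fun i _ => (hω i).trans
        (𝔉.monotoneOn i (Set.mem_Ici.2 h2) (Set.mem_Ici.2 (h2.trans hle)) hle)

theorem exists_normalized_le_mul {k' : ℕ} {s' : Fin k' → G} {𝔉' : WeightFunctions k'}
    (hs : Subgroup.closure (Set.range s) = ⊤) (hdoub : 𝔉.Doubling) (hdoub' : 𝔉'.Doubling)
    (i₀ : Fin k) (i₀' : Fin k')
    (h : UReach s' 𝔉' fun R g => ∃ ω, wordEval s ω = g ∧ ∀ i, (deg i ω : ℝ) ≤ 𝔉.F i R) :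
    ∃ C, 0 < C ∧ ∀ g, normalized s' 𝔉' i₀' g ≤ C * normalized s 𝔉 i₀ g := by
  obtain ⟨C₁, hC₁, h₁⟩ := exists_word_of_normalized hs hdoub i₀
  obtain ⟨C₂, h₂⟩ := h
  obtain ⟨C₃, hC₃, h₃⟩ := exists_normalized_le (s := s') hdoub' i₀' C₂
  refine ⟨C₃ * C₁, by positivity, fun g => ?_⟩
  rcases eq_or_ne g 1 with rfl | hg
  · simp [normalized_one]
  obtain ⟨hn, hω⟩ := h₁ g hg
  have hR : 1 ≤ C₁ * normalized s 𝔉 i₀ g := one_le_mul_of_one_le_of_one_le hC₁ hn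
  rw [mul_assoc]
  exact h₃ _ hR g (h₂ _ hR g hω)

end Norm

/-! ### Words as budgeted products, and depth -/

section Words

variable {G : Type*} [Group G] {k m d : ℕ}

theorem coll_wordEval (φ : FormalComm k → ℝ) (s : Fin m → G) (lab : Fin m → FormalComm k)
    (ω : List (Fin m × Bool)) :
    Coll φ ∅ ((fun p : Fin m × Bool => (if p.2 then s p.1 else (s p.1)⁻¹, lab p.1)) '' {p | p ∈ ω})
      0 (∑ i, deg i ω * (φ (lab i))⁻¹) (wordEval s ω) := by
  induction ω with
  | nil => simpa [wordEval, deg] using Coll.one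
  | cons p ω ih =>
    have h : ∀ i, deg i (p :: ω) = (if p.1 = i then 1 else 0) + deg i ω := by
      intro i; simp [deg, List.countP_cons, add_comm]
    have e : wordEval s (p :: ω) = (if p.2 then s p.1 else (s p.1)⁻¹) * wordEval s ω := by
      simp [wordEval]
    have e2 : ∑ i, (deg i (p :: ω) : ℝ) * (φ (lab i))⁻¹ =
        (φ (lab p.1))⁻¹ + ∑ i, deg i ω * (φ (lab i))⁻¹ := by
      simp [h, add_mul, Finset.sum_add_distrib]
    rw [e, e2]
    exact Coll.mul (n := 0) (n' := 0)
      (Coll.cons_one (a := (if p.2 then s p.1 else (s p.1)⁻¹, lab p.1))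
        ⟨p, List.mem_cons_self, rfl⟩)
      (ih.subset le_rfl (Set.image_mono fun q hq => List.mem_cons_of_mem _ hq))

theorem exists_isDepth [Group.IsNilpotent G] [NeZero k] {s : Fin k → G} {𝔴 : WeightSystem k d}
    (hs : Subgroup.closure (Set.range s) = ⊤) {g : G} (hg : ¬ IsOfFinOrder g) :
    ∃ j, IsDepth s 𝔴 g j := by
  obtain ⟨J, hJ⟩ := exists_filt_eq_bot (s := s) (𝔴 := 𝔴)
  have hne : {j | ∃ u : ℕ, 0 < u ∧ g ^ u ∈ filt s 𝔴 j}.Nonempty :=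
    ⟨0, 1, one_pos, by rw [filt_zero hs]; exact Subgroup.mem_top _⟩
  have hb : BddAbove {j | ∃ u : ℕ, 0 < u ∧ g ^ u ∈ filt s 𝔴 j} := by
    refine ⟨J, fun j ⟨u, hu, hgu⟩ => ?_⟩
    by_contra! h
    have := filt_antitone h.le hgu
    rw [hJ, Subgroup.mem_bot] at this
    exact hg (isOfFinOrder_iff_pow_eq_one.2 ⟨u, hu, this⟩)
  exact ⟨_, Nat.sSup_mem hne hb, fun j hj => le_csSup hb hj⟩

-- Condition (ii) does not control torsion letters. Deleting them changes the word only by an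
-- element of the finite torsion subgroup.
open Classical in
theorem wordEval_filter [Group.IsNilpotent G] (s : Fin m → G) (ω : List (Fin m × Bool)) :
    (wordEval s (ω.filter fun p => ¬ IsOfFinOrder (s p.1)))⁻¹ * wordEval s ω ∈
      torsionSubgroup G := by
  rw [← QuotientGroup.eq]
  have key : ∀ ω : List (Fin m × Bool), QuotientGroup.mk' (torsionSubgroup G) (wordEval s ω) =
      (ω.map fun p => ((if p.2 then s p.1 else (s p.1)⁻¹ : G) : G ⧸ torsionSubgroup G)).prod := by
    intro ω
    rw [wordEval, map_list_prod, List.map_map]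
    rfl
  change QuotientGroup.mk' (torsionSubgroup G) _ = QuotientGroup.mk' (torsionSubgroup G) _
  rw [key, key]
  induction ω with
  | nil => rfl
  | cons p ω ih =>
    by_cases h : IsOfFinOrder (s p.1)
    · have h1 : ((if p.2 then s p.1 else (s p.1)⁻¹ : G) : G ⧸ torsionSubgroup G) = 1 := by
        rw [QuotientGroup.eq_one_iff]
        split_ifs
        · exact h
        · exact (torsionSubgroup G).inv_mem h
      rw [List.filter_cons_of_neg (by simpa using h), List.map_cons, List.prod_cons, h1, one_mul, ih]
    · rw [List.filter_cons_of_pos (by simpa using h), List.map_cons, List.map_cons,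
        List.prod_cons, List.prod_cons, ih]

end Words

/-! ### Rewriting words from one generating tuple into another -/

section Comparison

variable {G : Type*} [Group G] [Group.IsNilpotent G] {k k' d : ℕ} [NeZero k] {s : Fin k → G}
  {𝔴 : WeightSystem k d} {𝔉 : WeightFunctions k} {s' : Fin k' → G} {𝔉' : WeightFunctions k'}
  {t : ℕ} {cs : Fin t → FormalComm k}

omit [Group.IsNilpotent G] [NeZero k] in
theorem uReach_core {K : ℝ} (hK : 0 < K) {i : Fin k} {j : Fin k'} (e : s' j = s i)
    (h : ∀ r, 1 ≤ r → 𝔉.F i r ≤ K * 𝔉'.F j r) (M : ℝ) :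
    UReach s' 𝔉' fun R g => ∃ x : ℕ, x ≤ M * 𝔉.F i R ∧ g = s i ^ x := by
  refine ⟨|M| * K, ?_⟩
  rintro R hR _ ⟨x, hx, rfl⟩
  refine ⟨List.replicate x (j, true), by simp [wordEval, e], fun i' => ?_⟩
  have h0 := 𝔉'.one_le i' R hR
  by_cases hij : i' = j
  · subst hij
    have h1 : deg i' (List.replicate x (i', true)) = x := by
      simp [deg, List.countP_replicate]
    have h2 := 𝔉.one_le i R hR
    rw [h1, mul_assoc]
    refine hx.trans (mul_le_mul (le_abs_self M) (h R hR) (by linarith) (abs_nonneg M))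
  · have h1 : deg i' (List.replicate x (j, true)) = 0 := by
      simp [deg, List.countP_replicate, Ne.symm hij]
    rw [h1, Nat.cast_zero]
    positivity

/-- After deletion of the torsion letters, the degree bounds say exactly that the word has bounded
cost with respect to the labels; `levelReach` applies. -/
theorem uReach_words (hs : Subgroup.closure (Set.range s) = ⊤)
    (hs' : Subgroup.closure (Set.range s') = ⊤) (hcs : IsAdapted s 𝔴 cs)
    (hcomp : 𝔉.Compatible 𝔴)
    (hcore : ∀ i ∈ core s 𝔴 cs, ∀ M,
      UReach s' 𝔉' fun R g => ∃ x : ℕ, x ≤ M * 𝔉.F i R ∧ g = s i ^ x)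
    {m : ℕ} (σ : Fin m → G) (Φ : Fin m → ℝ → ℝ) (lab : Fin m → FormalComm k) (B : ℝ)
    (hlab : ∀ i, ¬ IsOfFinOrder (σ i) → Admissible s 𝔴 (σ i, lab i) ∧
      ∀ R, 1 ≤ R → Φ i R ≤ B * 𝔉.comm (lab i) R) :
    UReach s' 𝔉' fun R g => ∃ ω, wordEval σ ω = g ∧ ∀ i, (deg i ω : ℝ) ≤ Φ i R := by
  classical
  set f := fun p : Fin m × Bool => (if p.2 then σ p.1 else (σ p.1)⁻¹, lab p.1) with hf
  set A := f '' {p | ¬ IsOfFinOrder (σ p.1)} with hA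
  have hmain := levelReach hs hs' hcs hcomp hcore A ?_ (fun a _ => 𝔴.wbar_zero_le _)
    (FiniteBelow.of_finite (Set.toFinite A)) (∑ _i : Fin m, |B|)
  · refine UReach.mul hmain (uReach_of_finite hs' (finite_isOfFinOrder hs hcs)) ?_
    rintro R hR _ ⟨ω, rfl, hω⟩
    refine ⟨_, _, ?_, wordEval_filter σ ω, (mul_inv_cancel_left _ _).symm⟩
    refine ((coll_wordEval (fun c => 𝔉.comm c R) σ lab _).subset le_rfl
      (Set.image_mono ?_)).mono (Finset.sum_le_sum fun i _ => ?_)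
    · intro p hp
      simpa using (List.mem_filter.1 hp).2
    · have h0 : 0 < 𝔉.comm (lab i) R := (𝔉.isSize hR).pos _
      rw [← div_eq_mul_inv, div_le_iff₀ h0]
      by_cases hi : IsOfFinOrder (σ i)
      · have : deg i (ω.filter fun p => ¬ IsOfFinOrder (σ p.1)) = 0 := by
          rw [deg, List.countP_eq_zero]
          intro p hp
          have h1 : ¬ IsOfFinOrder (σ p.1) := by simpa using (List.mem_filter.1 hp).2
          simp only [decide_eq_true_eq]
          rintro rfl
          exact h1 hi
        rw [this, Nat.cast_zero]
        positivity
      · have h1 : deg i (ω.filter fun p => ¬ IsOfFinOrder (σ p.1)) ≤ deg i ω :=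
          List.Sublist.countP_le List.filter_sublist
        calc ((deg i (ω.filter fun p => ¬ IsOfFinOrder (σ p.1)) : ℕ) : ℝ) ≤ deg i ω := by
              exact_mod_cast h1
          _ ≤ Φ i R := hω i
          _ ≤ B * 𝔉.comm (lab i) R := (hlab i hi).2 R hR
          _ ≤ |B| * 𝔉.comm (lab i) R := mul_le_mul_of_nonneg_right (le_abs_self B) h0.le
  · rintro _ ⟨⟨i, ε⟩, hi, rfl⟩
    obtain ⟨u, hu, h⟩ := (hlab i hi).1
    refine ⟨u, hu, ?_⟩
    cases ε
    · simpa [hf] using h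
    · simpa [hf] using h

theorem uReach_of_core (hs : Subgroup.closure (Set.range s) = ⊤)
    (hs' : Subgroup.closure (Set.range s') = ⊤) (hcs : IsAdapted s 𝔴 cs)
    (hcomp : 𝔉.Compatible 𝔴) {K : ℝ} (hK : 0 < K) (J : Fin k → Fin k')
    (hJ : ∀ i ∈ core s 𝔴 cs, s' (J i) = s i ∧ ∀ r, 1 ≤ r → 𝔉.F i r ≤ K * 𝔉'.F (J i) r) :
    UReach s' 𝔉' fun R g => ∃ ω, wordEval s ω = g ∧ ∀ i, (deg i ω : ℝ) ≤ 𝔉.F i R := by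
  refine uReach_words hs hs' hcs hcomp (fun i hi => uReach_core hK (hJ i hi).1 (hJ i hi).2)
    s 𝔉.F (fun i => letter i true) 1 fun i _ => ⟨⟨1, one_pos, ?_⟩, fun R _ => ?_⟩
  · rw [pow_one]
    exact eval_mem_filtGE (c := letter i true) le_rfl
  · rw [one_mul]; rfl

/-- Depth supplies a power in the filtration term, so a commutator of that level is an admissible
label. The target is S itself, which contains its own core. -/
theorem uReach_of_depth (hs : Subgroup.closure (Set.range s) = ⊤) (hcs : IsAdapted s 𝔴 cs)
    (hcomp : 𝔉.Compatible 𝔴) {K : ℝ} (hK : 0 < K) {Fbar : ℕ → ℝ → ℝ}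
    (hFbar : 𝔉.IsLevelFunction 𝔴 Fbar)
    (h : ∀ i j, IsDepth s 𝔴 (s' i) j → ∀ r, 1 ≤ r → 𝔉'.F i r ≤ K * Fbar j r) :
    UReach s 𝔉 fun R g => ∃ ω, wordEval s' ω = g ∧ ∀ i, (deg i ω : ℝ) ≤ 𝔉'.F i R := by
  have key : ∀ i, ∃ c : FormalComm k, ∃ B : ℝ, ¬ IsOfFinOrder (s' i) →
      Admissible s 𝔴 (s' i, c) ∧ ∀ R, 1 ≤ R → 𝔉'.F i R ≤ B * 𝔉.comm c R := by
    intro i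
    by_cases hi : IsOfFinOrder (s' i)
    · exact ⟨letter 0 true, 0, fun h => absurd hi h⟩
    obtain ⟨j, hj⟩ := exists_isDepth (𝔴 := 𝔴) hs hi
    obtain ⟨c, hc⟩ := 𝔴.wbar_mem_range j
    obtain ⟨a, b, -, hb, hab⟩ := hFbar j c hc
    obtain ⟨u, hu, hgu⟩ := hj.1
    refine ⟨c, K * b, fun _ => ⟨⟨u, hu, ?_⟩, fun R hR => ?_⟩⟩
    · change s' i ^ u ∈ filtGE s 𝔴 (𝔴.weight c)
      rw [hc]
      exact hgu
    · rw [mul_assoc]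
      exact (h i j hj R hR).trans (mul_le_mul_of_nonneg_left (hab R hR).2 hK.le)
  choose lab B hB using key
  obtain ⟨B₀, hB₀⟩ := (Set.finite_range B).bddAbove
  refine uReach_words hs hs hcs hcomp
    (fun i _ => uReach_core one_pos rfl fun r _ => (one_mul (𝔉.F i r)).ge) s' 𝔉'.F lab B₀
    fun i hi => ⟨(hB i hi).1, fun R hR => ((hB i hi).2 R hR).trans ?_⟩
  have : 0 < 𝔉.comm (lab i) R := (𝔉.isSize hR).pos _
  exact mul_le_mul_of_nonneg_right (hB₀ ⟨i, rfl⟩) this.le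

end Comparison

end NilpotentNorms

/-! ### The comparison theorem -/

theorem mainTheorem11 {G : Type*} [Group G] [Group.IsNilpotent G]
    {k k' d d' : ℕ}
    -- two generating tuples
    (s : Fin k → G) (hs : Subgroup.closure (Set.range s) = ⊤)
    (s' : Fin k' → G) (hs' : Subgroup.closure (Set.range s') = ⊤)
    -- weight systems and compatible weight-function systems
    (𝔴 : WeightSystem k d) (𝔉 : WeightFunctions k)
    (hdoub : 𝔉.Doubling) (hcomp : 𝔉.Compatible 𝔴)
    (𝔴' : WeightSystem k' d') (𝔉' : WeightFunctions k')
    (hdoub' : 𝔉'.Doubling) (hcomp' : 𝔉'.Compatible 𝔴')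
    -- letters of least weight, which define `F_S` and `F'_{S'}`
    (i₀ : Fin k) (hi₀ : ∀ i, 𝔴.w i₀ ≤ 𝔴.w i)
    (i₀' : Fin k') (hi₀' : ∀ i, 𝔴'.w i₀' ≤ 𝔴'.w i)
    -- the functions `𝐅_j`, one for each level
    (Fbar : ℕ → ℝ → ℝ) (hFbar : 𝔉.IsLevelFunction 𝔴 Fbar)
    -- an adapted tuple of formal commutators
    {t : ℕ} (cs : Fin t → FormalComm k) (hcs : IsAdapted s 𝔴 cs)
    (K : ℝ) (hK : 0 < K) :
    -- (1)
    ((∃ J : Fin k → Fin k', Set.InjOn J (core s 𝔴 cs) ∧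
        ∀ i ∈ core s 𝔴 cs, s' (J i) = s i ∧ ∀ r, 1 ≤ r → 𝔉.F i r ≤ K * 𝔉'.F (J i) r) →
      ∃ C : ℝ, 0 < C ∧ ∀ g, normalized s' 𝔉' i₀' g ≤ C * normalized s 𝔉 i₀ g) ∧
    -- (2)
    ((∀ i j, IsDepth s 𝔴 (s' i) j → ∀ r, 1 ≤ r → 𝔉'.F i r ≤ K * Fbar j r) →
      ∃ c : ℝ, 0 < c ∧ ∀ g, c * normalized s 𝔉 i₀ g ≤ normalized s' 𝔉' i₀' g) ∧
    -- (3)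
    ((∃ J : Fin k → Fin k', Set.InjOn J (core s 𝔴 cs) ∧
        ∀ i ∈ core s 𝔴 cs, s' (J i) = s i ∧ ∀ r, 1 ≤ r → 𝔉.F i r ≤ K * 𝔉'.F (J i) r) →
      (∀ i j, IsDepth s 𝔴 (s' i) j → ∀ r, 1 ≤ r → 𝔉'.F i r ≤ K * Fbar j r) →
      (∃ c C : ℝ, 0 < c ∧ 0 < C ∧ ∀ g,
        c * normalized s 𝔉 i₀ g ≤ normalized s' 𝔉' i₀' g ∧
        normalized s' 𝔉' i₀' g ≤ C * normalized s 𝔉 i₀ g) ∧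
      (∀ r, (ball s 𝔉 i₀ r).Finite ∧ (ball s' 𝔉' i₀' r).Finite) ∧
      ∃ a₁ a₂ a₃ a₄ : ℝ, 0 < a₁ ∧ 0 < a₂ ∧ 0 < a₃ ∧ 0 < a₄ ∧ ∀ r, 0 < r →
        a₁ * (ball s 𝔉 i₀ (a₂ * r)).ncard ≤ (ball s' 𝔉' i₀' r).ncard ∧
        ((ball s' 𝔉' i₀' r).ncard : ℝ) ≤ a₃ * (ball s 𝔉 i₀ (a₄ * r)).ncard) := by

  have : NeZero k := ⟨fun h => (h ▸ i₀).elim0⟩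
  have h1 : (∃ J : Fin k → Fin k', Set.InjOn J (core s 𝔴 cs) ∧
        ∀ i ∈ core s 𝔴 cs, s' (J i) = s i ∧ ∀ r, 1 ≤ r → 𝔉.F i r ≤ K * 𝔉'.F (J i) r) →
      ∃ C : ℝ, 0 < C ∧ ∀ g, normalized s' 𝔉' i₀' g ≤ C * normalized s 𝔉 i₀ g := by
    rintro ⟨J, -, hJ⟩
    exact exists_normalized_le_mul hs hdoub hdoub' i₀ i₀' (uReach_of_core hs hs' hcs hcomp hK J hJ)
  have h2 : (∀ i j, IsDepth s 𝔴 (s' i) j → ∀ r, 1 ≤ r → 𝔉'.F i r ≤ K * Fbar j r) →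
      ∃ c : ℝ, 0 < c ∧ ∀ g, c * normalized s 𝔉 i₀ g ≤ normalized s' 𝔉' i₀' g := by
    intro h
    obtain ⟨C, hC, hle⟩ := exists_normalized_le_mul hs' hdoub' hdoub i₀' i₀
      (uReach_of_depth hs hcs hcomp hK hFbar h)
    exact ⟨C⁻¹, inv_pos.2 hC, fun g => (inv_mul_le_iff₀ hC).2 (hle g)⟩
  refine ⟨h1, h2, fun hi hii => ?_⟩
  obtain ⟨C, hC, hle⟩ := h1 hi
  obtain ⟨c, hc, hge⟩ := h2 hii
  refine ⟨⟨c, C, hc, hC, fun g => ⟨hge g, hle g⟩⟩,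
    fun r => ⟨finite_ball hs hdoub i₀ r, finite_ball hs' hdoub' i₀' r⟩,
    -- The norm bounds give Q(S,C⁻¹r) ⊆ Q(S',r) ⊆ Q(S,c⁻¹r), so no factor is needed outside.
    -- Finiteness of the larger ball makes `Set.ncard` monotone.
    1, C⁻¹, 1, c⁻¹, one_pos, inv_pos.2 hC, one_pos, inv_pos.2 hc, fun r _ => ⟨?_, ?_⟩⟩
  · rw [one_mul, Nat.cast_le]
    refine Set.ncard_le_ncard (fun g hg => (hle g).trans ?_) (finite_ball hs' hdoub' i₀' r)
    exact (le_inv_mul_iff₀ hC).1 hg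
  · rw [one_mul, Nat.cast_le]
    refine Set.ncard_le_ncard (fun g hg => ?_) (finite_ball hs hdoub i₀ _)
    exact (le_inv_mul_iff₀ hc).2 ((hge g).trans hg)
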